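/- Let $T>0$, $I=[-T,T]$, and let $a\in L^1(I)$ be even and of constant sign ($a\ge 0$ a.e. or $a\le 0$ a.e.). Put $A(t)=\int_0^t a(s)\,ds$ and $\alpha=A(T)$, and assume $\alpha^2\neq (n\pi)^2$ for $n=0,1,2,\dots$ and $\cos\alpha\neq 0$. For $t,s\in I$, $t\ne s$, let $$2\sin(\alpha)\,G_1(t,s)=\begin{cases}\cos(A(s)+A(t)-\alpha)+\sin(A(s)-A(t)+\alpha), & t>|s|,\\ \cos(A(s)+A(t)-\alpha)-\sin(-A(s)+A(t)+\alpha), & s>|t|,\\ \cos(A(s)+A(t)+\alpha)-\sin(-A(s)+A(t)+\alpha), & -t>|s|,\\ \cos(A(s)+A(t)+\alpha)+\sin(A(s)-A(t)+\alpha), & -s>|t|,\end{cases}$$ extended continuously to the points with $t=-s\ne0$ (the adjacent branches agree there). This is the Green's function of $x'(t)+a(t)x(-t)=h(t)$, $x(-T)=x(T)$. On the diagonal $t=s$ let $G_1^{r}$ take the value of the formula valid for $s>t$ (the limit $s\to t^+$; the branch $s>|t|$ if $t\ge 0$, the branch $-t>|s|$ if $t<0$) and $G_1^{l}$ the value of the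 formula valid for $s<t$ (the limit $s\to t^-$; the branch $t>|s|$ if $t\ge0$, the branch $-s>|t|$ if $t<0$); off the diagonal $G_1^r=G_1^l=G_1$. Then: 1. If $\alpha\in(0,\pi/4)$, then $G_1^r$ and $G_1^l$ are strictly positive on $I^2$. 2. If $\alpha\in(-\pi/4,0)$, then $G_1^r$ and $G_1^l$ are strictly negative on $I^2$. 3. If $\alpha=\pi/4$, then $G_1^r$ vanishes on the set $Z^+$ of all $(t,s)\in I^2$ such that $(A(t),A(s))=(\alpha,-\alpha)$, or $t\le s$ and $(A(t),A(s))\in\{(-\alpha,-\alpha),(0,0),(\alpha,\alpha)\}$; and $G_1^r$ is strictly positive on $I^2\setminus Z^+$. The set $Z^+$ contains $P=\{(-T,-T),(0,0),(T,T),(T,-T)\}$, and $Z^+=P$ if $A$ is injective on $I$. 4. If $\alpha=-\pi/4$, then $G_1^l$ vanishes on the set $Z^-$ of all $(t,s)\in I^2$ such that $(A(t),A(s))=(-\alpha,\alpha)$, or $s\le t$ and $(A(t),A(s))\in\{(-\alpha,-\alpha),(0,0),(\alpha,\alpha)\}$; and $G_1^l$ is strictly negative on $I^2\setminus Z^-$.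 The set $Z^-$ contains $P'=\{(-T,-T),(0,0),(T,T),(-T,T)\}$, and $Z^-=P'$ if $A$ is injective on $I$. 5. If $\alpha\notin[-\pi/4,\pi/4]$, then $G_1$ takes both strictly positive and strictly negative values on $\{(t,s)\in I^2: t\neq s\}$. Furthermore, for $\lambda\in\mathbb R$ let $\mathcal F_\lambda(I)$ be the set of absolutely continuous $x:I\to\mathbb R$ with $x(-T)-x(T)=\lambda$, and let $R_a:\mathcal F_\lambda(I)\to L^1(I)$, $R_a x(t)=x'(t)+a(t)x(-t)$. Call $R_a$ strongly inverse positive (negative) on $\mathcal F_\lambda(I)$ if for all $x\in\mathcal F_\lambda(I)$, $R_a x\succ0$ implies $x>0$ (respectively $x<0$) everywhere on $I$. With $h\succ0$ meaning $h>0$ a.e. on $I$: 6. $R_a$ is strongly inverse positive if and only if $A(T)\in(0,\pi/4]$ and $\lambda\ge0$. 7. $R_a$ is strongly inverse negative if and only if $A(T)\in[-\pi/4,0)$ and $\lambda\ge0$. If $A$ is injective on $I$ or $|A(T)|\ne\pi/4$, then 6 and 7 also hold with $h\succ0$ meaning that $h\ge0$ a.e. on $I$ and $h$ is not a.e. zero.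 -/

import Mathlib

open MeasureTheory Set

noncomputable section

namespace ReflectionGreen

/-- The primitive `A(t) = ∫₀ᵗ a(s) ds`. -/
def primitive (a : ℝ → ℝ) (t : ℝ) : ℝ := ∫ s in (0 : ℝ)..t, a s

/-- The branches of the Green's function of the constant coefficient problem
`x'(t) + x(-t) = h(t)`, `x(α) = x(-α)`: the branch for `t > |s|`. -/
def branch₁ (α t s : ℝ) : ℝ :=
  (Real.cos (s + t - α) + Real.sin (s - t + α)) / (2 * Real.sin α)

/-- The branch for `s > |t|`. -/
def branch₂ (α t s : ℝ) : ℝ :=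
  (Real.cos (s + t - α) - Real.sin (-s + t + α)) / (2 * Real.sin α)

/-- The branch for `-t > |s|`. -/
def branch₃ (α t s : ℝ) : ℝ :=
  (Real.cos (s + t + α) - Real.sin (-s + t + α)) / (2 * Real.sin α)

/-- The branch for `-s > |t|`. -/
def branch₄ (α t s : ℝ) : ℝ :=
  (Real.cos (s + t + α) + Real.sin (s - t + α)) / (2 * Real.sin α)

/-- The kernel `G₁` on `I × I`, `I = [-T, T]`, glued from the branches evaluated at
`(A(t), A(s))`. The branches agree for `t + s = 0`, `t ≠ s`; at `t = s` the value of this version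
is the one-sided limit `G₁(t, t⁺)`. -/
def greenRight (a : ℝ → ℝ) (T t s : ℝ) : ℝ :=
  if s < t then
    if 0 ≤ t + s then branch₁ (primitive a T) (primitive a t) (primitive a s)
    else branch₄ (primitive a T) (primitive a t) (primitive a s)
  else
    if 0 ≤ t + s then branch₂ (primitive a T) (primitive a t) (primitive a s)
    else branch₃ (primitive a T) (primitive a t) (primitive a s)

/-- The same kernel `G₁`, whose value at `t = s` is the one-sided limit `G₁(t, t⁻)`. -/
def greenLeft (a : ℝ → ℝ) (T t s : ℝ) : ℝ :=
  if s ≤ t then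
    if 0 ≤ t + s then branch₁ (primitive a T) (primitive a t) (primitive a s)
    else branch₄ (primitive a T) (primitive a t) (primitive a s)
  else
    if 0 ≤ t + s then branch₂ (primitive a T) (primitive a t) (primitive a s)
    else branch₃ (primitive a T) (primitive a t) (primitive a s)

/-- The square `I × I`, `I = [-T, T]`. -/
def square (T : ℝ) : Set (ℝ × ℝ) := Icc (-T) T ×ˢ Icc (-T) T

/-- The zero set of `greenRight` when `A(T) = π/4`: the points of the square with
`(A(t), A(s)) = (A(T), -A(T))`, and those with `t ≤ s` at which `(A(t), A(s))` is one of
`(-A(T), -A(T))`, `(0, 0)`, `(A(T), A(T))`. -/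
def zerosRight (a : ℝ → ℝ) (T : ℝ) : Set (ℝ × ℝ) :=
  {z ∈ square T | (primitive a z.1, primitive a z.2) = (primitive a T, -primitive a T) ∨
    (z.1 ≤ z.2 ∧ (primitive a z.1, primitive a z.2) ∈
      ({(-primitive a T, -primitive a T), (0, 0), (primitive a T, primitive a T)} :
        Set (ℝ × ℝ)))}

/-- The zero set of `greenLeft` when `A(T) = -π/4`: the points of the square with
`(A(t), A(s)) = (-A(T), A(T))`, and those with `s ≤ t` at which `(A(t), A(s))` is one of
`(-A(T), -A(T))`, `(0, 0)`, `(A(T), A(T))`. -/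
def zerosLeft (a : ℝ → ℝ) (T : ℝ) : Set (ℝ × ℝ) :=
  {z ∈ square T | (primitive a z.1, primitive a z.2) = (-primitive a T, primitive a T) ∨
    (z.2 ≤ z.1 ∧ (primitive a z.1, primitive a z.2) ∈
      ({(-primitive a T, -primitive a T), (0, 0), (primitive a T, primitive a T)} :
        Set (ℝ × ℝ)))}

/-- `𝓕_lam(I)`: the absolutely continuous functions on `I = [-T, T]` with
`x(-T) - x(T) = lam`. -/
def MemF (T lam : ℝ) (x : ℝ → ℝ) : Prop :=
  AbsolutelyContinuousOnInterval x (-T) T ∧ x (-T) - x T = lam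

/-- The operator `R_a x (t) = x'(t) + a(t) x(-t)`, an element of `L¹(I)` for `x ∈ 𝓕_lam(I)`. -/
def reflOp (a x : ℝ → ℝ) (t : ℝ) : ℝ := deriv x t + a t * x (-t)

/-- `h > 0` almost everywhere on `I = [-T, T]`. -/
def AEPos (T : ℝ) (h : ℝ → ℝ) : Prop :=
  ∀ᵐ t ∂(volume.restrict (Icc (-T) T)), 0 < h t

/-- `h ≥ 0` almost everywhere on `I = [-T, T]`, and `h` is not almost everywhere zero. -/
def AENonnegNonzero (T : ℝ) (h : ℝ → ℝ) : Prop :=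
  (∀ᵐ t ∂(volume.restrict (Icc (-T) T)), 0 ≤ h t) ∧
    ¬ ∀ᵐ t ∂(volume.restrict (Icc (-T) T)), h t = 0

/-- `R_a` is strongly inverse positive on `𝓕_lam(I)`: `R_a x ≻ 0` implies `x > 0` on `I`. The
meaning of `h ≻ 0` on `[-T, T]` is the parameter `Pos`. -/
def StronglyInversePositive (Pos : ℝ → (ℝ → ℝ) → Prop) (a : ℝ → ℝ) (T lam : ℝ) : Prop :=
  ∀ x : ℝ → ℝ, MemF T lam x → Pos T (reflOp a x) → ∀ t ∈ Icc (-T) T, 0 < x t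

/-- `R_a` is strongly inverse negative on `𝓕_lam(I)`: `R_a x ≻ 0` implies `x < 0` on `I`. -/
def StronglyInverseNegative (Pos : ℝ → (ℝ → ℝ) → Prop) (a : ℝ → ℝ) (T lam : ℝ) : Prop :=
  ∀ x : ℝ → ℝ, MemF T lam x → Pos T (reflOp a x) → ∀ t ∈ Icc (-T) T, x t < 0

end ReflectionGreen

end

noncomputable section

namespace ReflectionGreen

open Filter Topology

/-! ### Absolute continuity -/

/-! Since `a` is even, its primitive `A` is odd, and rotating the pair (x(t), x(-t)) by the angle
A(t) + φ removes the unknown from the equation: the derivative of `rot` involves only h = R_a x,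
h(t) and h(-t). Two phases match the data. For φ = -π/4 the rotated function vanishes at 0, where t
= -t; for φ = -(α + π/4) its value at T is -λ√2/2. Integrating from 0 to t and from t to T gives two
linear equations for x(t) and x(-t) with determinant sin α, solved in `sin_mul_apply`.

If a ≥ 0 and 0 < α ≤ π/4, every trigonometric weight in that formula is nonnegative, which gives
inverse positivity for λ ≥ 0. At α = π/4 some weights vanish where A is 0 or α; injectivity of A
confines this on [0, T] to the end points, and this is what nonnegative nontrivial data require.

Conversely, x(T) is a weighted integral of h with weight cos A + sin A, plus a multiple of λ. Data
concentrated where the weight has the wrong sign force 0 < α ≤ π/4, and small constant data force λ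
≥ 0.

The sign of the kernel is treated separately. Each branch is a product of two factors cos u - sin u
divided by 2 sin α; the ordering of A(t), A(s) and α places u in [-π/4, π/4], where the factor
vanishes only at π/4. The negative cases follow by replacing a by -a, with x replaced by -x(-t) and
the kernel transposed. -/

theorem absolutelyContinuousOnInterval_comp_lipschitz {f g : ℝ → ℝ} {b c : ℝ} {K : NNReal}
    (hg : LipschitzWith K g) (hf : AbsolutelyContinuousOnInterval f b c) :
    AbsolutelyContinuousOnInterval (fun t => g (f t)) b c := by
  have h : Tendsto (fun E : ℕ × (ℕ → ℝ × ℝ) =>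
      K * ∑ i ∈ Finset.range E.1, dist (f (E.2 i).1) (f (E.2 i).2))
      (AbsolutelyContinuousOnInterval.totalLengthFilter ⊓
        𝓟 (AbsolutelyContinuousOnInterval.disjWithin b c)) (𝓝 0) := by
    simpa using Tendsto.const_mul (K : ℝ) hf
  refine squeeze_zero (fun E => Finset.sum_nonneg fun i _ => dist_nonneg) (fun E => ?_) h
  rw [Finset.mul_sum]
  exact Finset.sum_le_sum fun i _ => hg.dist_le_mul _ _

theorem absolutelyContinuousOnInterval_comp_neg {f : ℝ → ℝ} {T : ℝ}
    (hf : AbsolutelyContinuousOnInterval f (-T) T) :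
    AbsolutelyContinuousOnInterval (fun t => f (-t)) (-T) T := by
  rw [absolutelyContinuousOnInterval_iff] at hf ⊢
  intro ε hε
  obtain ⟨δ, hδ, H⟩ := hf ε hε
  refine ⟨δ, hδ, fun E hE hlen => ?_⟩
  refine H (E.1, fun i => (-(E.2 i).1, -(E.2 i).2)) ?_ (by simpa [dist_neg_neg] using hlen)
  obtain ⟨h1, h2⟩ := hE
  refine ⟨fun i hi => ?_, fun i hi j hj hij => ?_⟩
  · have := h1 i hi
    simp only [mem_uIcc] at this ⊢
    grind
  · have := h2 hi hj hij
    -- Negation moves the open end of a half-open interval, but disjointness is an inequality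
    -- between end points that negation preserves.
    simp only [Function.onFun, uIoc, Ioc_disjoint_Ioc] at this ⊢
    grind

/-! ### The primitive of an even function -/

section Primitive

variable {a : ℝ → ℝ} {T : ℝ}

theorem ae_Icc_iff {p : ℝ → Prop} :
    (∀ᵐ t ∂(volume.restrict (Icc (-T) T)), p t) ↔ ∀ᵐ t, t ∈ Icc (-T) T → p t :=
  ae_restrict_iff' measurableSet_Icc

theorem ae_Icc_neg {p : ℝ → Prop} (h : ∀ᵐ t, t ∈ Icc (-T) T → p t) :
    ∀ᵐ t, t ∈ Icc (-T) T → p (-t) := by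
  have := (Measure.measurePreserving_neg (volume : Measure ℝ)).quasiMeasurePreserving.ae h
  filter_upwards [this] with t ht h
  exact ht ⟨by linarith [h.2], by linarith [h.1]⟩

theorem intervalIntegrable_of_mem {f : ℝ → ℝ} (hf : IntegrableOn f (Icc (-T) T)) {s t : ℝ}
    (hs : s ∈ Icc (-T) T) (ht : t ∈ Icc (-T) T) : IntervalIntegrable f volume s t := by
  rw [intervalIntegrable_iff]
  exact hf.mono_set (uIoc_subset_uIcc.trans (uIcc_subset_Icc hs ht))

theorem primitive_zero (a : ℝ → ℝ) : primitive a 0 = 0 := by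
  simp [primitive]

theorem primitive_fun_neg (a : ℝ → ℝ) (t : ℝ) :
    primitive (fun s => -a s) t = -primitive a t := by
  simp [primitive]

theorem primitive_neg (heven : ∀ᵐ t ∂(volume.restrict (Icc (-T) T)), a (-t) = a t) {t : ℝ}
    (ht : t ∈ Icc (-T) T) : primitive a (-t) = -primitive a t := by
  rw [ae_Icc_iff] at heven
  have h : ∫ s in (0 : ℝ)..t, a s = ∫ s in (0 : ℝ)..t, a (-s) := by
    refine intervalIntegral.integral_congr_ae ?_
    filter_upwards [heven] with s hs hst
    refine (hs ?_).symm
    have := uIoc_subset_uIcc hst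
    rw [mem_uIcc] at this
    constructor <;> rcases this with h | h <;> linarith [h.1, h.2, ht.1, ht.2]
  rw [primitive, primitive, h, intervalIntegral.integral_comp_neg, neg_zero,
    intervalIntegral.integral_symm]

theorem absolutelyContinuous_primitive (hT : 0 ≤ T) (ha : IntegrableOn a (Icc (-T) T)) :
    AbsolutelyContinuousOnInterval (primitive a) (-T) T :=
  (intervalIntegrable_of_mem ha (by simp [hT]) (by simp [hT]
    )).absolutelyContinuousOnInterval_intervalIntegral
    (by rw [uIcc_of_le (by linarith)]; exact ⟨by linarith, hT⟩)

theorem continuousOn_primitive (hT : 0 ≤ T) (ha : IntegrableOn a (Icc (-T) T)) :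
    ContinuousOn (primitive a) (Icc (-T) T) := by
  simpa [uIcc_of_le (show -T ≤ T by linarith)] using (absolutelyContinuous_primitive hT ha).continuousOn

theorem ae_hasDerivAt_primitive (hT : 0 ≤ T) (ha : IntegrableOn a (Icc (-T) T)) :
    ∀ᵐ t, t ∈ Icc (-T) T → HasDerivAt (primitive a) (a t) t := by
  have h := (intervalIntegrable_of_mem ha (s := -T) (t := T) (by simp [hT])
    (by simp [hT])).ae_hasDerivAt_integral
  filter_upwards [h] with t ht htI
  rw [uIcc_of_le (by linarith)] at ht
  exact ht htI 0 ⟨by linarith, hT⟩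

theorem monotoneOn_primitive (hT : 0 ≤ T) (ha : IntegrableOn a (Icc (-T) T))
    (hpos : ∀ᵐ t ∂(volume.restrict (Icc (-T) T)), 0 ≤ a t) :
    MonotoneOn (primitive a) (Icc (-T) T) := by
  intro s hs t ht hst
  have h0 : (0 : ℝ) ∈ Icc (-T) T := ⟨by linarith, hT⟩
  have h := intervalIntegral.integral_interval_sub_left (intervalIntegrable_of_mem ha h0 ht)
    (intervalIntegrable_of_mem ha h0 hs)
  have h2 : 0 ≤ ∫ r in s..t, a r := by
    refine intervalIntegral.integral_nonneg_of_ae_restrict hst ?_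
    exact ae_restrict_of_ae_restrict_of_subset (Icc_subset_Icc hs.1 ht.2) hpos
  unfold primitive
  linarith

/-- The other sign would give A(T) ≤ 0. The constant-sign hypothesis enters the positive case only
through this. -/
theorem nonneg_of_primitive_pos (hT : 0 ≤ T) (hsign :
      (∀ᵐ t ∂(volume.restrict (Icc (-T) T)), 0 ≤ a t) ∨
      (∀ᵐ t ∂(volume.restrict (Icc (-T) T)), a t ≤ 0)) (h : 0 < primitive a T) :
    ∀ᵐ t ∂(volume.restrict (Icc (-T) T)), 0 ≤ a t := by
  refine hsign.resolve_right fun hneg => h.not_ge ?_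
  have h2 : 0 ≤ ∫ r in (0 : ℝ)..T, -a r := by
    refine intervalIntegral.integral_nonneg_of_ae_restrict hT ?_
    filter_upwards [ae_restrict_of_ae_restrict_of_subset
      (Icc_subset_Icc_left (by linarith : -T ≤ 0)) hneg] with t ht
    simpa using ht
  rw [intervalIntegral.integral_neg] at h2
  unfold primitive
  linarith

end Primitive

/-! ### The reflected equation as a rotation -/

section Rotation

variable {a x : ℝ → ℝ} {T : ℝ}

/-- The combination of `x(t)` and `x(-t)` by the rotation of angle `A(t) + φ`. -/
def rot (a x : ℝ → ℝ) (φ t : ℝ) : ℝ :=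
  Real.cos (primitive a t + φ) * x t + Real.sin (primitive a t + φ) * x (-t)

/-- The derivative of `rot` along `x' + a x(-·) = h`. -/
def rotRhs (a h : ℝ → ℝ) (φ t : ℝ) : ℝ :=
  Real.cos (primitive a t + φ) * h t - Real.sin (primitive a t + φ) * h (-t)

theorem lipschitzWith_cos_add (φ : ℝ) : LipschitzWith 1 fun t : ℝ => Real.cos (t + φ) :=
  lipschitzWith_of_nnnorm_deriv_le (by fun_prop) fun t => by
    rw [deriv_comp_add_const (f := Real.cos)]
    simpa [← NNReal.coe_le_coe] using Real.abs_sin_le_one _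

theorem lipschitzWith_sin_add (φ : ℝ) : LipschitzWith 1 fun t : ℝ => Real.sin (t + φ) :=
  lipschitzWith_of_nnnorm_deriv_le (by fun_prop) fun t => by
    rw [deriv_comp_add_const (f := Real.sin)]
    simpa [← NNReal.coe_le_coe] using Real.abs_cos_le_one _

theorem absolutelyContinuous_rot (hT : 0 ≤ T) (ha : IntegrableOn a (Icc (-T) T))
    (hx : AbsolutelyContinuousOnInterval x (-T) T) (φ : ℝ) :
    AbsolutelyContinuousOnInterval (rot a x φ) (-T) T :=
  ((absolutelyContinuousOnInterval_comp_lipschitz (lipschitzWith_cos_add φ)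
    (absolutelyContinuous_primitive hT ha)).fun_mul hx).fun_add
  ((absolutelyContinuousOnInterval_comp_lipschitz (lipschitzWith_sin_add φ)
    (absolutelyContinuous_primitive hT ha)).fun_mul (absolutelyContinuousOnInterval_comp_neg hx))

/-- Evenness makes the same factor a(t) multiply x(-t) in the equation at t and x(t) in the equation
at -t; these terms cancel against the derivative of the angle. -/
theorem ae_hasDerivAt_rot (hT : 0 ≤ T) (ha : IntegrableOn a (Icc (-T) T))
    (heven : ∀ᵐ t ∂(volume.restrict (Icc (-T) T)), a (-t) = a t)
    (hx : AbsolutelyContinuousOnInterval x (-T) T) (φ : ℝ) :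
    ∀ᵐ t, t ∈ Icc (-T) T → HasDerivAt (rot a x φ) (rotRhs a (reflOp a x) φ t) t := by
  have hd := hx.ae_differentiableAt
  rw [uIcc_of_le (by linarith)] at hd
  filter_upwards [hd, ae_Icc_neg hd, ae_hasDerivAt_primitive hT ha, ae_Icc_iff.1 heven]
    with t h1 h2 h3 h4 ht
  have e1 := (h1 ht).hasDerivAt
  have e2 : HasDerivAt (fun s => x (-s)) (-deriv x (-t)) t := by
    simpa [Function.comp_def] using (h2 ht).hasDerivAt.comp t (hasDerivAt_neg t)
  have e3 := (h3 ht).add_const φ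
  have e := (e3.cos.mul e1).add (e3.sin.mul e2)
  refine e.congr_deriv ?_
  simp only [rotRhs, reflOp, h4 ht, neg_neg]
  ring

theorem integral_rotRhs (hT : 0 ≤ T) (ha : IntegrableOn a (Icc (-T) T))
    (heven : ∀ᵐ t ∂(volume.restrict (Icc (-T) T)), a (-t) = a t)
    (hx : AbsolutelyContinuousOnInterval x (-T) T) (φ : ℝ) {s t : ℝ}
    (hs : s ∈ Icc (-T) T) (ht : t ∈ Icc (-T) T) :
    ∫ r in s..t, rotRhs a (reflOp a x) φ r = rot a x φ t - rot a x φ s := by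
  have hsub : uIcc s t ⊆ Icc (-T) T := uIcc_subset_Icc hs ht
  have h := ((absolutelyContinuous_rot hT ha hx φ).mono
    (hsub.trans_eq (uIcc_of_le (by linarith)).symm)).integral_deriv_eq_sub
  rw [← h]
  refine intervalIntegral.integral_congr_ae ?_
  filter_upwards [ae_hasDerivAt_rot hT ha heven hx φ] with r hr hrI
  exact (hr (hsub (uIoc_subset_uIcc hrI))).deriv.symm

/-- It is almost everywhere the derivative of an absolutely continuous function, so integrability of
R_a x need not be discussed. -/
theorem integrableOn_rotRhs (hT : 0 ≤ T) (ha : IntegrableOn a (Icc (-T) T))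
    (heven : ∀ᵐ t ∂(volume.restrict (Icc (-T) T)), a (-t) = a t)
    (hx : AbsolutelyContinuousOnInterval x (-T) T) (φ : ℝ) :
    IntegrableOn (rotRhs a (reflOp a x) φ) (Icc (-T) T) := by
  have h := (absolutelyContinuous_rot hT ha hx φ).intervalIntegrable_deriv
  rw [intervalIntegrable_iff_integrableOn_Icc_of_le (by linarith)] at h
  refine h.congr ?_
  filter_upwards [ae_Icc_iff.2 (ae_hasDerivAt_rot hT ha heven hx φ)] with r hr
  exact hr.deriv

/-- Variation of parameters on `[0, T]`: the values at `t` and at `-t`. -/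
theorem sin_mul_apply (hT : 0 ≤ T) (ha : IntegrableOn a (Icc (-T) T))
    (heven : ∀ᵐ t ∂(volume.restrict (Icc (-T) T)), a (-t) = a t) {lam : ℝ}
    (hx : MemF T lam x) {t : ℝ} (ht : t ∈ Icc 0 T) :
    (Real.sin (primitive a T) * x t =
      Real.sin (primitive a T + Real.pi / 4 - primitive a t) *
        (∫ r in (0 : ℝ)..t, rotRhs a (reflOp a x) (-(Real.pi / 4)) r) +
      Real.sin (Real.pi / 4 - primitive a t) * (lam * (√2 / 2) +
        ∫ r in t..T, rotRhs a (reflOp a x) (-(primitive a T + Real.pi / 4)) r)) ∧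
    (Real.sin (primitive a T) * x (-t) =
      Real.cos (primitive a T + Real.pi / 4 - primitive a t) *
        (∫ r in (0 : ℝ)..t, rotRhs a (reflOp a x) (-(Real.pi / 4)) r) +
      Real.cos (Real.pi / 4 - primitive a t) * (lam * (√2 / 2) +
        ∫ r in t..T, rotRhs a (reflOp a x) (-(primitive a T + Real.pi / 4)) r)) := by
  have h0 : (0 : ℝ) ∈ Icc (-T) T := ⟨by linarith, hT⟩
  have h1 : T ∈ Icc (-T) T := ⟨by linarith, le_rfl⟩
  have h2 : t ∈ Icc (-T) T := ⟨by linarith [ht.1], ht.2⟩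
  rw [integral_rotRhs hT ha heven hx.1 _ h0 h2, integral_rotRhs hT ha heven hx.1 _ h2 h1]
  obtain ⟨-, hl⟩ := hx
  have e : x (-T) = x T + lam := by linarith
  have hT' : rot a x (-(primitive a T + Real.pi / 4)) T = -(lam * (√2 / 2)) := by
    rw [rot, show primitive a T + -(primitive a T + Real.pi / 4) = -(Real.pi / 4) by ring, e,
      Real.cos_neg, Real.sin_neg, Real.cos_pi_div_four, Real.sin_pi_div_four]
    ring
  have h0' : rot a x (-(Real.pi / 4)) 0 = 0 := by
    rw [rot, primitive_zero]
    simp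
  rw [hT', h0', rot, rot]
  set p := primitive a t
  set α := primitive a T
  -- The two angles differ by α, so the subtraction formula exhibits sin α as the determinant of the
  -- system.
  rw [show Real.sin α = Real.sin ((α + Real.pi / 4 - p) - (Real.pi / 4 - p)) by ring_nf,
    Real.sin_sub (α + Real.pi / 4 - p), show p + -(Real.pi / 4) = -(Real.pi / 4 - p) by ring,
    show p + -(α + Real.pi / 4) = -(α + Real.pi / 4 - p) by ring,
    Real.cos_neg, Real.sin_neg, Real.cos_neg, Real.sin_neg]
  constructor <;> ring

end Rotation

/-! ### Existence of solutions -/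

section Existence

variable {a : ℝ → ℝ} {T : ℝ}

/-- The solution of `x' + a x(-·) = h` obtained by variation of parameters, with `x(0) = C`. -/
def solution (a h : ℝ → ℝ) (C t : ℝ) : ℝ :=
  Real.cos (primitive a t) * (C + primitive (rotRhs a h 0) t) -
    Real.sin (primitive a t) * (C + primitive (rotRhs a h 0) (-t))

theorem continuousOn_rotRhs (hT : 0 ≤ T) (ha : IntegrableOn a (Icc (-T) T))
    {h : ℝ → ℝ} (hh : ContinuousOn h (Icc (-T) T)) (φ : ℝ) :
    ContinuousOn (rotRhs a h φ) (Icc (-T) T) := by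
  have hA := continuousOn_primitive hT ha
  have hn : ContinuousOn (fun t => h (-t)) (Icc (-T) T) :=
    hh.comp continuousOn_neg fun t ht => ⟨by linarith [ht.2], by linarith [ht.1]⟩
  have hA' := hA.add (continuousOn_const (c := φ))
  exact ((Real.continuous_cos.comp_continuousOn hA').mul hh).sub
    ((Real.continuous_sin.comp_continuousOn hA').mul hn)

theorem absolutelyContinuous_solution (hT : 0 ≤ T) (ha : IntegrableOn a (Icc (-T) T))
    {h : ℝ → ℝ} (hh : ContinuousOn h (Icc (-T) T)) (C : ℝ) :
    AbsolutelyContinuousOnInterval (solution a h C) (-T) T := by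
  have hA := absolutelyContinuous_primitive hT ha
  have hc := absolutelyContinuousOnInterval_comp_lipschitz (lipschitzWith_cos_add 0) hA
  have hs := absolutelyContinuousOnInterval_comp_lipschitz (lipschitzWith_sin_add 0) hA
  simp only [add_zero] at hc hs
  have hC : AbsolutelyContinuousOnInterval (fun _ : ℝ => C) (-T) T :=
    contDiffOn_const.absolutelyContinuousOnInterval
  have hU := absolutelyContinuous_primitive hT
    (continuousOn_rotRhs hT ha hh 0).integrableOn_Icc
  have h1 := hc.fun_mul (hC.fun_add hU)
  have h2 := hs.fun_mul (hC.fun_add (absolutelyContinuousOnInterval_comp_neg hU))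
  exact h1.fun_sub h2

theorem ae_reflOp_solution (hT : 0 ≤ T) (ha : IntegrableOn a (Icc (-T) T))
    (heven : ∀ᵐ t ∂(volume.restrict (Icc (-T) T)), a (-t) = a t)
    {h : ℝ → ℝ} (hh : ContinuousOn h (Icc (-T) T)) (C : ℝ) :
    ∀ᵐ t ∂(volume.restrict (Icc (-T) T)), reflOp a (solution a h C) t = h t := by
  have hU := ae_hasDerivAt_primitive hT
    (continuousOn_rotRhs hT ha hh 0).integrableOn_Icc
  rw [ae_Icc_iff]
  filter_upwards [hU, ae_Icc_neg hU, ae_hasDerivAt_primitive hT ha] with t h1 h2 h3 ht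
  have e1 := (h1 ht).const_add C
  have e2 : HasDerivAt (fun s => C + primitive (rotRhs a h 0) (-s)) (-rotRhs a h 0 (-t)) t := by
    simpa [Function.comp_def] using ((h2 ht).comp t (hasDerivAt_neg t)).const_add C
  have e3 := h3 ht
  have e : HasDerivAt (solution a h C) _ t := (e3.cos.mul e1).sub (e3.sin.mul e2)
  have e4 : rotRhs a h 0 t =
      Real.cos (primitive a t) * h t - Real.sin (primitive a t) * h (-t) := by
    simp [rotRhs]
  have e5 : rotRhs a h 0 (-t) =
      Real.cos (primitive a t) * h (-t) + Real.sin (primitive a t) * h t := by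
    simp [rotRhs, primitive_neg heven ht]
  rw [reflOp, e.deriv, solution, neg_neg, primitive_neg heven ht, Real.cos_neg, Real.sin_neg,
    e4, e5]
  -- The terms containing `a` and those in h(-t) cancel; only (cos² + sin²) h(t) is left.
  linear_combination h t * Real.sin_sq_add_cos_sq (primitive a t)

theorem exists_memF_reflOp_eq (hT : 0 ≤ T) (ha : IntegrableOn a (Icc (-T) T))
    (heven : ∀ᵐ t ∂(volume.restrict (Icc (-T) T)), a (-t) = a t)
    (hsin : Real.sin (primitive a T) ≠ 0)
    {h : ℝ → ℝ} (hh : ContinuousOn h (Icc (-T) T)) (lam : ℝ) :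
    ∃ x, MemF T lam x ∧ ∀ᵐ t ∂(volume.restrict (Icc (-T) T)), reflOp a x t = h t := by
  set U := primitive (rotRhs a h 0)
  -- With x(0) = C the boundary jump is affine in C with slope 2 sin α; this C solves for the jump
  -- λ.
  refine ⟨solution a h ((lam - Real.cos (primitive a T) * (U (-T) - U T) -
    Real.sin (primitive a T) * (U T + U (-T))) / (2 * Real.sin (primitive a T))),
    ⟨absolutelyContinuous_solution hT ha hh _, ?_⟩, ae_reflOp_solution hT ha heven hh _⟩
  rw [solution, solution, neg_neg, primitive_neg heven ⟨by linarith, le_rfl⟩, Real.cos_neg,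
    Real.sin_neg]
  field_simp
  ring

end Existence

/-! ### Necessary conditions -/

section Necessity

variable {a : ℝ → ℝ} {T : ℝ}

/-- The value at the right end point, as an integral over the whole interval. -/
theorem two_mul_sin_mul_apply_right (hT : 0 ≤ T) (ha : IntegrableOn a (Icc (-T) T))
    (heven : ∀ᵐ t ∂(volume.restrict (Icc (-T) T)), a (-t) = a t) {lam : ℝ} {x h : ℝ → ℝ}
    (hx : MemF T lam x) (hh : ContinuousOn h (Icc (-T) T))
    (hxh : ∀ᵐ t ∂(volume.restrict (Icc (-T) T)), reflOp a x t = h t) :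
    2 * Real.sin (primitive a T) * x T =
      (∫ t in -T..T, (Real.cos (primitive a t) + Real.sin (primitive a t)) * h t) +
        (Real.cos (primitive a T) - Real.sin (primitive a T)) * lam := by
  have h0 : (0 : ℝ) ∈ Icc (-T) T := ⟨by linarith, hT⟩
  have h1 : T ∈ Icc (-T) T := ⟨by linarith, le_rfl⟩
  have h2 : -T ∈ Icc (-T) T := ⟨le_rfl, by linarith⟩
  set g : ℝ → ℝ := fun t => (Real.cos (primitive a t) + Real.sin (primitive a t)) * h t with hg
  have hgc : ContinuousOn g (Icc (-T) T) := by
    have hA := continuousOn_primitive hT ha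
    fun_prop
  have hgi := hgc.integrableOn_Icc (μ := volume)
  have hgn : ContinuousOn (fun t => g (-t)) (Icc (-T) T) :=
    hgc.comp continuousOn_neg fun t ht => ⟨by linarith [ht.2], by linarith [ht.1]⟩
  have e1 := (sin_mul_apply hT ha heven hx ⟨hT, le_rfl⟩).1
  rw [intervalIntegral.integral_same, show primitive a T + Real.pi / 4 - primitive a T = Real.pi / 4
    by ring, Real.sin_sub, Real.sin_pi_div_four, Real.cos_pi_div_four] at e1
  -- At phase -π/4 the integrand is symmetric under r ↦ -r up to the factor √2/2, so the integral
  -- over [0, T] unfolds to [-T, T].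
  have e2 : ∫ r in (0 : ℝ)..T, rotRhs a (reflOp a x) (-(Real.pi / 4)) r =
      ∫ r in (0 : ℝ)..T, (√2 / 2) * (g r + g (-r)) := by
    refine intervalIntegral.integral_congr_ae ?_
    have hxh' := ae_Icc_iff.1 hxh
    filter_upwards [hxh', ae_Icc_neg hxh'] with r h3 h4 hr
    have hrI : r ∈ Icc (-T) T := by
      rw [uIoc_of_le hT] at hr
      exact ⟨by linarith [hr.1], hr.2⟩
    rw [rotRhs, h3 hrI, h4 hrI, Real.cos_add, Real.sin_add, Real.cos_neg, Real.sin_neg,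
      Real.cos_pi_div_four, Real.sin_pi_div_four]
    simp only [hg, primitive_neg heven hrI, Real.cos_neg, Real.sin_neg]
    ring
  have e3 : ∫ t in -T..T, g t = (∫ t in (0 : ℝ)..T, g t) + ∫ t in (0 : ℝ)..T, g (-t) := by
    rw [intervalIntegral.integral_comp_neg, neg_zero, add_comm,
      intervalIntegral.integral_add_adjacent_intervals (intervalIntegrable_of_mem hgi h2 h0)
        (intervalIntegrable_of_mem hgi h0 h1)]
  rw [e2, intervalIntegral.integral_const_mul, intervalIntegral.integral_add
    (intervalIntegrable_of_mem hgi h0 h1)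
    (intervalIntegrable_of_mem hgn.integrableOn_Icc h0 h1), ← e3] at e1
  linear_combination 2 * e1 + ((∫ t in -T..T, g t) / 2 + lam / 2 *
    (Real.cos (primitive a T) - Real.sin (primitive a T))) * Real.sq_sqrt (zero_le_two (α := ℝ))

/-- Take h = 1 + n max(g, 0): the 1 keeps h positive, and the integral grows linearly in n with
slope ∫ g max(g, 0) > 0. -/
theorem exists_continuousOn_integral_gt (hT : 0 < T) {g : ℝ → ℝ} (hg : ContinuousOn g (Icc (-T) T))
    {s : ℝ} (hs : s ∈ Icc (-T) T) (hgs : 0 < g s) (C : ℝ) :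
    ∃ h : ℝ → ℝ, ContinuousOn h (Icc (-T) T) ∧ (∀ t, 0 < h t) ∧ C < ∫ t in -T..T, g t * h t := by
  have hm : ContinuousOn (fun t => max (g t) 0) (Icc (-T) T) := hg.sup continuousOn_const
  have hpos : 0 < ∫ t in -T..T, g t * max (g t) 0 := by
    refine intervalIntegral.integral_pos (by linarith) (hg.mul hm) (fun t _ => ?_)
      ⟨s, hs, by simp [hgs]⟩
    rcases le_total (g t) 0 with h | h
    · simp [h]
    · positivity
  obtain ⟨n, hn⟩ := exists_nat_gt ((C - ∫ t in -T..T, g t) / ∫ t in -T..T, g t * max (g t) 0)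
  refine ⟨fun t => 1 + n * max (g t) 0, by fun_prop, fun t => by positivity, ?_⟩
  have hT' : -T ≤ T := by linarith
  have e : ∫ t in -T..T, g t * (1 + n * max (g t) 0) =
      (∫ t in -T..T, g t) + n * ∫ t in -T..T, g t * max (g t) 0 := by
    rw [← intervalIntegral.integral_const_mul, ← intervalIntegral.integral_add]
    · exact intervalIntegral.integral_congr fun t _ => by ring
    · exact hg.intervalIntegrable_of_Icc hT'
    · exact ((hg.mul hm).intervalIntegrable_of_Icc hT').const_mul _
  rw [e]
  rw [div_lt_iff₀ hpos] at hn
  linarith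

theorem exists_primitive_eq (hT : 0 ≤ T) (ha : IntegrableOn a (Icc (-T) T))
    (heven : ∀ᵐ t ∂(volume.restrict (Icc (-T) T)), a (-t) = a t) {q : ℝ}
    (hq : |q| ≤ |primitive a T|) : ∃ s ∈ Icc (-T) T, primitive a s = q := by
  have hc := continuousOn_primitive hT ha
  have h1 : T ∈ Icc (-T) T := ⟨by linarith, le_rfl⟩
  have h2 : -T ∈ Icc (-T) T := ⟨le_rfl, by linarith⟩
  have hn := primitive_neg heven h1
  rcases le_total 0 (primitive a T) with h | h
  · rw [abs_of_nonneg h, abs_le] at hq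
    exact isPreconnected_Icc.intermediate_value h2 h1 hc (by rw [hn]; exact hq)
  · rw [abs_of_nonpos h, abs_le] at hq
    exact isPreconnected_Icc.intermediate_value h1 h2 hc
      (by rw [hn]; exact ⟨by linarith [hq.1], hq.2⟩)

theorem StronglyInversePositive.mono {P Q : ℝ → (ℝ → ℝ) → Prop} {lam : ℝ}
    (H : StronglyInversePositive P a T lam) (hPQ : ∀ h, Q T h → P T h) :
    StronglyInversePositive Q a T lam :=
  fun x hx h => H x hx (hPQ _ h)

theorem AEPos.aenonnegNonzero (hT : 0 < T) {h : ℝ → ℝ} (H : AEPos T h) :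
    AENonnegNonzero T h := by
  refine ⟨H.mono fun t ht => ht.le, fun h0 => ?_⟩
  have : ∀ᵐ t ∂(volume.restrict (Icc (-T) T)), False := by
    filter_upwards [H, h0] with t h1 h2
    exact h1.ne' h2
  rw [eventually_false_iff_eq_bot, ae_eq_bot, Measure.restrict_eq_zero, Real.volume_Icc,
    ENNReal.ofReal_eq_zero] at this
  linarith

theorem exists_cos_add_sin_neg {α : ℝ} (hα : Real.pi / 4 < |α|) :
    ∃ q : ℝ, |q| < |α| ∧ Real.cos q + Real.sin q < 0 := by
  have hpi := Real.pi_pos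
  -- At q = -m the sum equals -√2 sin(m - π/4), negative for m slightly above π/4.
  obtain ⟨m, h1, h2⟩ := exists_between (lt_min hα (by linarith : Real.pi / 4 < Real.pi / 2))
  rw [lt_min_iff] at h2
  refine ⟨-m, by rw [abs_neg, abs_of_pos (by linarith)]; exact h2.1, ?_⟩
  have h3 : 0 < Real.sin (m - Real.pi / 4) := Real.sin_pos_of_pos_of_lt_pi (by linarith)
    (by linarith)
  rw [Real.sin_sub, Real.cos_pi_div_four, Real.sin_pi_div_four] at h3
  rw [Real.cos_neg, Real.sin_neg]
  have : 0 < √(2 : ℝ) := by positivity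
  nlinarith

theorem StronglyInversePositive.necessary (hT : 0 < T) (ha : IntegrableOn a (Icc (-T) T))
    (heven : ∀ᵐ t ∂(volume.restrict (Icc (-T) T)), a (-t) = a t)
    (hsin : Real.sin (primitive a T) ≠ 0) {lam : ℝ}
    (H : StronglyInversePositive AEPos a T lam) :
    primitive a T ∈ Ioc 0 (Real.pi / 4) ∧ 0 ≤ lam := by
  have h1 : T ∈ Icc (-T) T := ⟨by linarith, le_rfl⟩
  have hpi := Real.pi_pos
  set w : ℝ → ℝ := fun t => Real.cos (primitive a t) + Real.sin (primitive a t) with hw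
  have hwc : ContinuousOn w (Icc (-T) T) := by
    have hA := continuousOn_primitive hT.le ha
    fun_prop
  -- positivity of the solution at `T`, for every continuous positive right-hand side
  have key : ∀ h : ℝ → ℝ, ContinuousOn h (Icc (-T) T) → (∀ t, 0 < h t) →
      ∃ x : ℝ → ℝ, 0 < x T ∧ 0 < x (-T) ∧ x (-T) - x T = lam ∧
        2 * Real.sin (primitive a T) * x T = (∫ t in -T..T, w t * h t) +
        (Real.cos (primitive a T) - Real.sin (primitive a T)) * lam := by
    intro h hh hpos
    obtain ⟨x, hx, hxh⟩ := exists_memF_reflOp_eq hT.le ha heven hsin hh lam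
    have hxp : ∀ t ∈ Icc (-T) T, 0 < x t := H x hx (hxh.mono fun t ht => ht ▸ hpos t)
    exact ⟨x, hxp T h1, hxp (-T) ⟨le_rfl, by linarith⟩, hx.2,
      two_mul_sin_mul_apply_right hT.le ha heven hx hh hxh⟩
  have hsp : 0 < Real.sin (primitive a T) := by
    by_contra hneg
    have hneg : Real.sin (primitive a T) < 0 := lt_of_le_of_ne (not_lt.1 hneg) hsin
    -- The weight is 1 at 0, so suitable data outweigh the λ term and make 2 sin(α) x(T) positive,
    -- against sin α < 0.
    obtain ⟨h, hh, hpos, hC⟩ := exists_continuousOn_integral_gt hT hwc (s := 0)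
      ⟨by linarith, hT.le⟩ (by simp [hw, primitive_zero])
      (-((Real.cos (primitive a T) - Real.sin (primitive a T)) * lam))
    obtain ⟨x, hxT, -, -, hx⟩ := key h hh hpos
    nlinarith
  have hle : |primitive a T| ≤ Real.pi / 4 := by
    by_contra hgt
    -- Beyond π/4 the weight is negative somewhere on I; data concentrated there make x(T) negative.
    obtain ⟨q, hq, hq'⟩ := exists_cos_add_sin_neg (not_le.1 hgt)
    obtain ⟨s, hs, rfl⟩ := exists_primitive_eq hT.le ha heven hq.le
    obtain ⟨h, hh, hpos, hC⟩ := exists_continuousOn_integral_gt hT hwc.neg hs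
      (neg_pos.2 hq') ((Real.cos (primitive a T) - Real.sin (primitive a T)) * lam)
    obtain ⟨x, hxT, -, -, hx⟩ := key h hh hpos
    simp only [Pi.neg_apply, neg_mul, intervalIntegral.integral_neg] at hC
    nlinarith
  rw [abs_le] at hle
  have hα : 0 < primitive a T := by
    by_contra hneg
    exact hsp.not_ge (Real.sin_nonpos_of_nonpos_of_neg_pi_le (not_lt.1 hneg) (by linarith))
  refine ⟨⟨hα, hle.2⟩, ?_⟩
  by_contra hlam
  have hlam := not_le.1 hlam
  have hcos : 0 < Real.cos (primitive a T) :=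
    Real.cos_pos_of_mem_Ioo ⟨by linarith, by linarith⟩
  -- a small constant right-hand side
  set K := ∫ t in -T..T, w t with hK
  set ε := -((Real.cos (primitive a T) + Real.sin (primitive a T)) * lam) / (|K| + 1) with hε
  have hε0 : 0 < ε := div_pos (by nlinarith) (by positivity)
  obtain ⟨x, -, hxT, hl, hx⟩ := key (fun _ => ε) continuousOn_const fun _ => hε0
  rw [intervalIntegral.integral_mul_const, ← hK] at hx
  have h3 : (|K| + 1) * ε = -((Real.cos (primitive a T) + Real.sin (primitive a T)) * lam) := by
    rw [hε]; field_simp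
  have h4 : K * ε ≤ |K| * ε := mul_le_mul_of_nonneg_right (le_abs_self K) hε0.le
  -- Passing to -T by the boundary condition changes the coefficient of λ to cos α + sin α > 0. By
  -- the choice of ε the right side is at most -ε.
  have h5 : 2 * Real.sin (primitive a T) * x (-T) = K * ε +
      (Real.cos (primitive a T) + Real.sin (primitive a T)) * lam := by
    linear_combination hx + 2 * Real.sin (primitive a T) * hl
  nlinarith [mul_pos hsp hxT]

end Necessity

/-! ### Sufficient conditions -/

section Sufficiency

variable {a : ℝ → ℝ} {T : ℝ}

theorem intervalIntegral_pos_of_ae_pos {f : ℝ → ℝ} {s t : ℝ} (hst : s < t)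
    (hf : IntervalIntegrable f volume s t) (hpos : ∀ᵐ r, r ∈ Ioc s t → 0 < f r) :
    0 < ∫ r in s..t, f r := by
  have hpos' := (ae_restrict_iff' measurableSet_Ioc).2 hpos
  have hnn : 0 ≤ᵐ[volume.restrict (Ioc s t)] f := hpos'.mono fun r hr => hr.le
  refine lt_of_le_of_ne (intervalIntegral.integral_nonneg_of_ae_restrict hst.le
    (by rwa [restrict_Ioc_eq_restrict_Icc] at hnn)) fun h0 => ?_
  rw [eq_comm, intervalIntegral.integral_eq_zero_iff_of_le_of_nonneg_ae hst.le hnn hf] at h0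
  have : ∀ᵐ t ∂(volume.restrict (Ioc s t)), False := by
    filter_upwards [hpos', h0] with t h1 h2
    exact h1.ne' h2
  rw [eventually_false_iff_eq_bot, ae_eq_bot, Measure.restrict_eq_zero, Real.volume_Ioc,
    ENNReal.ofReal_eq_zero] at this
  linarith

/-- Signs of the weights of the variation of parameters formula. -/
theorem weights {α p : ℝ} (hα : α ∈ Ioc 0 (Real.pi / 4)) (hp : p ∈ Icc 0 α) :
    0 < Real.cos (Real.pi / 4 - p) ∧ 0 ≤ Real.sin (Real.pi / 4 - p) ∧
    0 ≤ Real.cos (α + Real.pi / 4 - p) ∧ 0 < Real.sin (α + Real.pi / 4 - p) := by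
  obtain ⟨h1, h2⟩ := hα
  obtain ⟨h3, h4⟩ := hp
  have := Real.pi_pos
  refine ⟨Real.cos_pos_of_mem_Ioo ⟨?_, ?_⟩, Real.sin_nonneg_of_nonneg_of_le_pi ?_ ?_,
    Real.cos_nonneg_of_neg_pi_div_two_le_of_le ?_ ?_, Real.sin_pos_of_pos_of_lt_pi ?_ ?_⟩ <;>
  linarith

/-- The sine vanishes only for p = α = π/4, the cosine only for p = 0 and α = π/4. -/
theorem weights_pos {α p : ℝ} (hα : α ∈ Ioc 0 (Real.pi / 4)) (hp : p ∈ Icc 0 α)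
    (h : α < Real.pi / 4 ∨ p ∈ Ioo 0 α) :
    0 < Real.sin (Real.pi / 4 - p) ∧ 0 < Real.cos (α + Real.pi / 4 - p) := by
  obtain ⟨h1, h2⟩ := hα
  obtain ⟨h3, h4⟩ := hp
  have := Real.pi_pos
  refine ⟨Real.sin_pos_of_pos_of_lt_pi ?_ ?_, Real.cos_pos_of_mem_Ioo ⟨?_, ?_⟩⟩ <;>
  rcases h with h | ⟨h5, h6⟩ <;> linarith

theorem rotRhs_eq_left (a h : ℝ → ℝ) (t : ℝ) : rotRhs a h (-(Real.pi / 4)) t =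
    Real.cos (Real.pi / 4 - primitive a t) * h t +
      Real.sin (Real.pi / 4 - primitive a t) * h (-t) := by
  rw [rotRhs, show primitive a t + -(Real.pi / 4) = -(Real.pi / 4 - primitive a t) by ring,
    Real.cos_neg, Real.sin_neg]
  ring

theorem rotRhs_eq_right (a h : ℝ → ℝ) (α t : ℝ) : rotRhs a h (-(α + Real.pi / 4)) t =
    Real.cos (α + Real.pi / 4 - primitive a t) * h t +
      Real.sin (α + Real.pi / 4 - primitive a t) * h (-t) := by
  rw [rotRhs, show primitive a t + -(α + Real.pi / 4) = -(α + Real.pi / 4 - primitive a t) by ring,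
    Real.cos_neg, Real.sin_neg]
  ring

theorem primitive_mem_Icc (hT : 0 ≤ T) (ha : IntegrableOn a (Icc (-T) T))
    (hpos : ∀ᵐ t ∂(volume.restrict (Icc (-T) T)), 0 ≤ a t) {t : ℝ} (ht : t ∈ Icc 0 T) :
    primitive a t ∈ Icc 0 (primitive a T) := by
  have hm := monotoneOn_primitive hT ha hpos
  have h2 : t ∈ Icc (-T) T := ⟨by linarith [ht.1], ht.2⟩
  refine ⟨?_, hm h2 ⟨by linarith, le_rfl⟩ ht.2⟩
  simpa [primitive_zero] using hm ⟨by linarith, hT⟩ h2 ht.1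

theorem ae_rotRhs_nonneg (hT : 0 ≤ T) (ha : IntegrableOn a (Icc (-T) T))
    (hpos : ∀ᵐ t ∂(volume.restrict (Icc (-T) T)), 0 ≤ a t)
    (hα : primitive a T ∈ Ioc 0 (Real.pi / 4)) {h : ℝ → ℝ}
    (hh : ∀ᵐ t ∂(volume.restrict (Icc (-T) T)), 0 ≤ h t) :
    ∀ᵐ t, t ∈ Icc 0 T → 0 ≤ rotRhs a h (-(Real.pi / 4)) t ∧
      0 ≤ rotRhs a h (-(primitive a T + Real.pi / 4)) t := by
  rw [ae_Icc_iff] at hh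
  filter_upwards [hh, ae_Icc_neg hh] with t h1 h2 ht
  have ht' : t ∈ Icc (-T) T := ⟨by linarith [ht.1], ht.2⟩
  obtain ⟨w1, w2, w3, w4⟩ := weights hα (primitive_mem_Icc hT ha hpos ht)
  have h1 := h1 ht'
  have h2 := h2 ht'
  rw [rotRhs_eq_left, rotRhs_eq_right]
  constructor <;> positivity

theorem forall_mem_Icc_of_nonneg {p : ℝ → Prop} (h : ∀ t ∈ Icc 0 T, p t ∧ p (-t)) :
    ∀ t ∈ Icc (-T) T, p t := by
  intro t ht
  rcases le_total 0 t with h0 | h0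
  · exact (h t ⟨h0, ht.2⟩).1
  · simpa using (h (-t) ⟨by linarith, by linarith [ht.1]⟩).2

/-- Each integrand has one strictly positive weight, so an integral over a nondegenerate interval is
positive. In x(t) the first integral has positive weight, in x(-t) the second; when that integral is
empty (t = 0 or t = T), the other carries the weight √2/2. -/
theorem stronglyInversePositive_aePos (hT : 0 < T) (ha : IntegrableOn a (Icc (-T) T))
    (heven : ∀ᵐ t ∂(volume.restrict (Icc (-T) T)), a (-t) = a t)
    (hpos : ∀ᵐ t ∂(volume.restrict (Icc (-T) T)), 0 ≤ a t)
    (hα : primitive a T ∈ Ioc 0 (Real.pi / 4)) {lam : ℝ} (hlam : 0 ≤ lam) :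
    StronglyInversePositive AEPos a T lam := by
  intro x hx hh
  have hpi := Real.pi_pos
  have hsin : 0 < Real.sin (primitive a T) :=
    Real.sin_pos_of_pos_of_lt_pi hα.1 (by linarith [hα.2])
  refine forall_mem_Icc_of_nonneg fun t ht => ?_
  obtain ⟨e1, e2⟩ := sin_mul_apply hT.le ha heven hx ht
  obtain ⟨w1, w2, w3, w4⟩ := weights hα (primitive_mem_Icc hT.le ha hpos ht)
  have h0 : (0 : ℝ) ∈ Icc (-T) T := ⟨by linarith, hT.le⟩
  have h1 : T ∈ Icc (-T) T := ⟨by linarith, le_rfl⟩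
  have h2 : t ∈ Icc (-T) T := ⟨by linarith [ht.1], ht.2⟩
  have hhp := ae_Icc_iff.1 hh
  have hrp : ∀ᵐ r, r ∈ Icc 0 T → 0 < rotRhs a (reflOp a x) (-(Real.pi / 4)) r ∧
      0 < rotRhs a (reflOp a x) (-(primitive a T + Real.pi / 4)) r := by
    filter_upwards [hhp, ae_Icc_neg hhp] with r h3 h4 hr
    have hr' : r ∈ Icc (-T) T := ⟨by linarith [hr.1], hr.2⟩
    obtain ⟨w1, w2, w3, w4⟩ := weights hα (primitive_mem_Icc hT.le ha hpos hr)
    have h3 := h3 hr'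
    have h4 := h4 hr'
    rw [rotRhs_eq_left, rotRhs_eq_right]
    constructor <;> positivity
  have J1 : 0 < t → 0 < ∫ r in (0 : ℝ)..t, rotRhs a (reflOp a x) (-(Real.pi / 4)) r := fun h =>
    intervalIntegral_pos_of_ae_pos h
      (intervalIntegrable_of_mem (integrableOn_rotRhs hT.le ha heven hx.1 _) h0 h2)
      (hrp.mono fun r hr hrI => (hr ⟨hrI.1.le, hrI.2.trans ht.2⟩).1)
  have J2 : t < T →
      0 < ∫ r in t..T, rotRhs a (reflOp a x) (-(primitive a T + Real.pi / 4)) r := fun h =>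
    intervalIntegral_pos_of_ae_pos h
      (intervalIntegrable_of_mem (integrableOn_rotRhs hT.le ha heven hx.1 _) h2 h1)
      (hrp.mono fun r hr hrI => (hr ⟨ht.1.trans hrI.1.le, hrI.2⟩).2)
  have hl : 0 ≤ lam * (√2 / 2) := by positivity
  refine ⟨pos_of_mul_pos_right (a := Real.sin (primitive a T)) ?_ hsin.le,
    pos_of_mul_pos_right (a := Real.sin (primitive a T)) ?_ hsin.le⟩
  · rw [e1]
    rcases ht.1.eq_or_lt with rfl | h
    · have := J2 hT
      rw [intervalIntegral.integral_same, primitive_zero, sub_zero (Real.pi / 4),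
        Real.sin_pi_div_four, mul_zero, zero_add]
      positivity
    · have hJ1 := J1 h
      have hJ2 : 0 ≤ ∫ r in t..T, rotRhs a (reflOp a x) (-(primitive a T + Real.pi / 4)) r := by
        rcases ht.2.eq_or_lt with rfl | h'
        · simp
        · exact (J2 h').le
      positivity
  · rw [e2]
    rcases ht.2.eq_or_lt with rfl | h
    · have := J1 hT
      rw [intervalIntegral.integral_same, add_sub_cancel_left, Real.cos_pi_div_four]
      positivity
    · have hJ2 := J2 h
      have hJ1 : 0 ≤ ∫ r in (0 : ℝ)..t, rotRhs a (reflOp a x) (-(Real.pi / 4)) r := by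
        rcases ht.1.eq_or_lt with rfl | h'
        · simp
        · exact (J1 h').le
      positivity

/-- All weights are positive in the open interval, so if both integrals vanished then h(r) and h(-r)
would vanish almost everywhere. Hence one integral is positive, and its weight at t is positive too.
-/
theorem stronglyInversePositive_aenonnegNonzero (hT : 0 < T) (ha : IntegrableOn a (Icc (-T) T))
    (heven : ∀ᵐ t ∂(volume.restrict (Icc (-T) T)), a (-t) = a t)
    (hpos : ∀ᵐ t ∂(volume.restrict (Icc (-T) T)), 0 ≤ a t)
    (hα : primitive a T ∈ Ioc 0 (Real.pi / 4))
    (hstrict : InjOn (primitive a) (Icc (-T) T) ∨ |primitive a T| ≠ Real.pi / 4)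
    {lam : ℝ} (hlam : 0 ≤ lam) :
    StronglyInversePositive AENonnegNonzero a T lam := by
  intro x hx ⟨hh, hne⟩
  have hpi := Real.pi_pos
  have hsin : 0 < Real.sin (primitive a T) :=
    Real.sin_pos_of_pos_of_lt_pi hα.1 (by linarith [hα.2])
  have h0 : (0 : ℝ) ∈ Icc (-T) T := ⟨by linarith, hT.le⟩
  have h1 : T ∈ Icc (-T) T := ⟨by linarith, le_rfl⟩
  -- in the interior all the weights are positive
  have hw : ∀ r ∈ Ioo 0 T, 0 < Real.sin (Real.pi / 4 - primitive a r) ∧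
      0 < Real.cos (primitive a T + Real.pi / 4 - primitive a r) := by
    intro r hr
    have hp := primitive_mem_Icc hT.le ha hpos (Ioo_subset_Icc_self hr)
    refine weights_pos hα hp ?_
    rcases hstrict with hinj | hlt
    · right
      have hr' : r ∈ Icc (-T) T := ⟨by linarith [hr.1], hr.2.le⟩
      refine ⟨lt_of_le_of_ne hp.1 fun h => hr.1.ne ?_, lt_of_le_of_ne hp.2 fun h => hr.2.ne ?_⟩
      · exact hinj h0 hr' (by rw [primitive_zero]; exact h)
      · exact hinj hr' h1 h
    · left
      rw [abs_of_pos hα.1] at hlt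
      exact lt_of_le_of_ne hα.2 hlt
  refine forall_mem_Icc_of_nonneg fun t ht => ?_
  obtain ⟨e1, e2⟩ := sin_mul_apply hT.le ha heven hx ht
  have h2 : t ∈ Icc (-T) T := ⟨by linarith [ht.1], ht.2⟩
  have hnn := ae_rotRhs_nonneg hT.le ha hpos hα hh
  have i1 := intervalIntegrable_of_mem
    (integrableOn_rotRhs hT.le ha heven hx.1 (-(Real.pi / 4))) h0 h2
  have i2 := intervalIntegrable_of_mem
    (integrableOn_rotRhs hT.le ha heven hx.1 (-(primitive a T + Real.pi / 4))) h2 h1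
  have n1 : 0 ≤ᵐ[volume.restrict (Ioc 0 t)] rotRhs a (reflOp a x) (-(Real.pi / 4)) :=
    (ae_restrict_iff' measurableSet_Ioc).2
      (hnn.mono fun r hr hrI => (hr ⟨hrI.1.le, hrI.2.trans ht.2⟩).1)
  have n2 : 0 ≤ᵐ[volume.restrict (Ioc t T)]
      rotRhs a (reflOp a x) (-(primitive a T + Real.pi / 4)) :=
    (ae_restrict_iff' measurableSet_Ioc).2
      (hnn.mono fun r hr hrI => (hr ⟨ht.1.trans hrI.1.le, hrI.2⟩).2)
  have z1 := intervalIntegral.integral_eq_zero_iff_of_le_of_nonneg_ae ht.1 n1 i1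
  have z2 := intervalIntegral.integral_eq_zero_iff_of_le_of_nonneg_ae ht.2 n2 i2
  have J1 : 0 ≤ ∫ r in (0 : ℝ)..t, rotRhs a (reflOp a x) (-(Real.pi / 4)) r :=
    intervalIntegral.integral_nonneg_of_ae_restrict ht.1
      (by rwa [restrict_Ioc_eq_restrict_Icc] at n1)
  have J2 : 0 ≤ ∫ r in t..T, rotRhs a (reflOp a x) (-(primitive a T + Real.pi / 4)) r :=
    intervalIntegral.integral_nonneg_of_ae_restrict ht.2
      (by rwa [restrict_Ioc_eq_restrict_Icc] at n2)
  set j1 := ∫ r in (0 : ℝ)..t, rotRhs a (reflOp a x) (-(Real.pi / 4)) r with hj1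
  set j2 := ∫ r in t..T, rotRhs a (reflOp a x) (-(primitive a T + Real.pi / 4)) r with hj2
  have hsum : j1 ≠ 0 ∨ j2 ≠ 0 := by
    by_contra! hz
    refine hne ?_
    have y1 := (ae_restrict_iff' measurableSet_Ioc).1 (z1.1 hz.1)
    have y2 := (ae_restrict_iff' measurableSet_Ioc).1 (z2.1 hz.2)
    have hh' := ae_Icc_iff.1 hh
    have hzero : ∀ᵐ r, r ∈ Ioo 0 T → reflOp a x r = 0 ∧ reflOp a x (-r) = 0 := by
      filter_upwards [hh', ae_Icc_neg hh', y1, y2] with r g1 g2 g3 g4 hr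
      have hr' : r ∈ Icc (-T) T := ⟨by linarith [hr.1], hr.2.le⟩
      obtain ⟨w1, w2, w3, w4⟩ := weights hα
        (primitive_mem_Icc hT.le ha hpos (Ioo_subset_Icc_self hr))
      obtain ⟨w5, w6⟩ := hw r hr
      have g1 := g1 hr'
      have g2 := g2 hr'
      have aux : ∀ u v : ℝ, 0 < u → 0 < v →
          u * reflOp a x r + v * reflOp a x (-r) = 0 →
          reflOp a x r = 0 ∧ reflOp a x (-r) = 0 := fun u v hu hv h => by
        constructor <;> nlinarith [mul_nonneg hu.le g1, mul_nonneg hv.le g2]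
      rcases le_or_gt r t with hrt | hrt
      · have := g3 ⟨hr.1, hrt⟩
        rw [rotRhs_eq_left] at this
        exact aux _ _ w1 w5 this
      · have := g4 ⟨hrt, hr.2.le⟩
        rw [rotRhs_eq_right] at this
        exact aux _ _ w6 w4 this
    have hzero' : ∀ᵐ r, -r ∈ Ioo 0 T → reflOp a x (-r) = 0 ∧ reflOp a x (- -r) = 0 :=
      (Measure.measurePreserving_neg (volume : Measure ℝ)).quasiMeasurePreserving.ae hzero
    rw [ae_Icc_iff]
    have hne : ∀ c : ℝ, ∀ᵐ r : ℝ, r ≠ c := fun c => by simp [ae_iff, measure_singleton]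
    filter_upwards [hzero, hzero', hne 0, hne T, hne (-T)] with r g1 g2 g3 g4 g5 hr
    rcases lt_or_gt_of_ne g3 with h | h
    · simpa using (g2 ⟨by linarith, by
        have := lt_of_le_of_ne hr.1 g5.symm
        linarith⟩).2
    · exact (g1 ⟨h, lt_of_le_of_ne hr.2 g4⟩).1
  have hl : 0 ≤ lam * (√2 / 2) := by positivity
  -- positive weights at `t`
  have hfin : ∀ u v : ℝ, 0 ≤ u → 0 ≤ v → (j1 ≠ 0 → 0 < u) → (j2 ≠ 0 → 0 < v) →
      0 < u * j1 + v * (lam * (√2 / 2) + j2) := by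
    intro u v hu hv hu' hv'
    rcases hsum with h | h
    · have hpos := hu' h
      have := lt_of_le_of_ne J1 h.symm
      positivity
    · have hpos := hv' h
      have := lt_of_le_of_ne J2 h.symm
      positivity
  obtain ⟨w1, w2, w3, w4⟩ := weights hα (primitive_mem_Icc hT.le ha hpos ht)
  refine ⟨pos_of_mul_pos_right (a := Real.sin (primitive a T)) ?_ hsin.le,
    pos_of_mul_pos_right (a := Real.sin (primitive a T)) ?_ hsin.le⟩
  · rw [e1]
    refine hfin _ _ w4.le w2 (fun _ => w4) fun hj => ?_
    rcases ht.1.eq_or_lt with rfl | h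
    · rw [primitive_zero, sub_zero, Real.sin_pi_div_four]
      positivity
    -- At t = T the weight may be 0, but the second integral is then empty, contrary to `hj`.
    · refine (hw t ⟨h, lt_of_le_of_ne ht.2 ?_⟩).1
      rintro rfl
      exact hj (by simp [hj2])
  · rw [e2]
    refine hfin _ _ w3 w1.le (fun hj => ?_) fun _ => w1
    rcases ht.2.eq_or_lt with rfl | h
    · rw [add_sub_cancel_left, Real.cos_pi_div_four]
      positivity
    · refine (hw t ⟨lt_of_le_of_ne ht.1 ?_, h⟩).2
      rintro rfl
      exact hj (by simp [hj1])

end Sufficiency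

/-! ### The symmetry between the positive and the negative case -/

section Symmetry

variable {a : ℝ → ℝ} {T : ℝ}

/-- For even `a` the right side is R_a x(-t), so x ↦ -x(-·) carries R_a to R_{-a} with reflected
data. -/
theorem reflOp_neg_comp_neg (a x : ℝ → ℝ) (t : ℝ) :
    reflOp (fun s => -a s) (fun s => -x (-s)) t = deriv x (-t) + a t * x t := by
  have h : deriv (fun s => -x (-s)) t = deriv x (-t) := by
    rw [deriv.fun_neg, deriv_comp_neg, neg_neg]
  simp only [reflOp, h, neg_neg]
  ring

theorem memF_neg_comp_neg {x : ℝ → ℝ} {lam : ℝ} (hx : MemF T lam x) :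
    MemF T lam fun s => -x (-s) :=
  ⟨(absolutelyContinuousOnInterval_comp_neg hx.1).fun_neg, by
    have := hx.2
    simp only [neg_neg]
    linarith⟩

theorem ae_reflOp_neg_comp_neg
    (heven : ∀ᵐ t ∂(volume.restrict (Icc (-T) T)), a (-t) = a t) (x : ℝ → ℝ) :
    ∀ᵐ t, t ∈ Icc (-T) T →
      reflOp (fun s => -a s) (fun s => -x (-s)) t = reflOp a x (-t) := by
  filter_upwards [ae_Icc_iff.1 heven] with t ht htI
  rw [reflOp_neg_comp_neg, reflOp, neg_neg, ht htI]

theorem AEPos.comp_neg {h k : ℝ → ℝ} (hk : ∀ᵐ t, t ∈ Icc (-T) T → k t = h (-t))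
    (H : AEPos T h) : AEPos T k := by
  have H' := ae_Icc_neg (ae_Icc_iff.1 H)
  refine ae_Icc_iff.2 ?_
  filter_upwards [H', hk] with t h1 h2 ht
  rw [h2 ht]
  exact h1 ht

theorem AENonnegNonzero.comp_neg {h k : ℝ → ℝ} (hk : ∀ᵐ t, t ∈ Icc (-T) T → k t = h (-t))
    (H : AENonnegNonzero T h) : AENonnegNonzero T k := by
  have H' := ae_Icc_neg (ae_Icc_iff.1 H.1)
  refine ⟨ae_Icc_iff.2 ?_, fun H0 => H.2 (ae_Icc_iff.2 ?_)⟩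
  · filter_upwards [H', hk] with t h1 h2 ht
    rw [h2 ht]
    exact h1 ht
  · filter_upwards [ae_Icc_neg (ae_Icc_iff.1 H0), ae_Icc_neg hk] with t h1 h2 ht
    rw [← h1 ht, h2 ht, neg_neg]

/-- The substitution x ↦ -x(-·) preserves λ and reverses the sign of x. Invariance of `P` under
reflection is all that is needed, so both notions of positive data are covered. -/
theorem stronglyInverseNegative_iff {P : ℝ → (ℝ → ℝ) → Prop}
    (hP : ∀ h k : ℝ → ℝ, (∀ᵐ t, t ∈ Icc (-T) T → k t = h (-t)) → P T h → P T k)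
    (heven : ∀ᵐ t ∂(volume.restrict (Icc (-T) T)), a (-t) = a t) (lam : ℝ) :
    StronglyInverseNegative P a T lam ↔ StronglyInversePositive P (fun s => -a s) T lam := by
  have hneg : ∀ t ∈ Icc (-T) T, -t ∈ Icc (-T) T := fun t ht =>
    ⟨by linarith [ht.2], by linarith [ht.1]⟩
  constructor
  · intro H x hx hxP t ht
    have heven' : ∀ᵐ t ∂(volume.restrict (Icc (-T) T)), -a (-t) = -a t :=
      heven.mono fun t ht => by rw [ht]
    have h := H _ (memF_neg_comp_neg hx) (hP _ _ (by
      simpa using ae_reflOp_neg_comp_neg (a := fun s => -a s) heven' x) hxP) _ (hneg t ht)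
    simpa using h
  · intro H x hx hxP t ht
    have h := H _ (memF_neg_comp_neg hx) (hP _ _ (ae_reflOp_neg_comp_neg heven x) hxP) _ (hneg t ht)
    simpa using h

end Symmetry

/-! ### Signs of the kernel -/

section Kernel

/-- The difference is √2 sin(π/4 - x). -/
theorem cos_sub_sin_pos {x : ℝ} (h1 : -(Real.pi / 4) ≤ x) (h2 : x ≤ Real.pi / 4)
    (h3 : x ≠ Real.pi / 4) : 0 < Real.cos x - Real.sin x := by
  have hpi := Real.pi_pos
  have h4 := lt_of_le_of_ne h2 h3
  have h : 0 < Real.sin (Real.pi / 4 - x) :=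
    Real.sin_pos_of_pos_of_lt_pi (by linarith) (by linarith)
  rw [Real.sin_sub, Real.cos_pi_div_four, Real.sin_pi_div_four] at h
  have : 0 < √(2 : ℝ) := by positivity
  nlinarith

/-- All four factorizations are instances of (cos u - sin u)(cos v - sin v) = cos(u - v) - sin(u +
v); they separate the dependence on t from that on s. -/
theorem branch₁_eq (α p q : ℝ) : branch₁ α p q =
    (Real.cos (p - α) - Real.sin (p - α)) * (Real.cos (-q) - Real.sin (-q)) /
      (2 * Real.sin α) := by
  rw [branch₁, show q + p - α = q + (p - α) by ring, show q - p + α = q - (p - α) by ring,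
    Real.cos_add, Real.sin_sub q, Real.cos_neg, Real.sin_neg]
  ring

theorem branch₂_eq (α p q : ℝ) : branch₂ α p q =
    (Real.cos p - Real.sin p) * (Real.cos (α - q) - Real.sin (α - q)) /
      (2 * Real.sin α) := by
  rw [branch₂, show q + p - α = p - (α - q) by ring, show -q + p + α = p + (α - q) by ring,
    Real.cos_sub p, Real.sin_add p]
  ring

theorem branch₃_eq (α p q : ℝ) : branch₃ α p q =
    (Real.cos (p + α) - Real.sin (p + α)) * (Real.cos (-q) - Real.sin (-q)) /
      (2 * Real.sin α) := by
  rw [branch₃, show q + p + α = q + (p + α) by ring, show -q + p + α = (p + α) - q by ring,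
    Real.cos_add q, Real.sin_sub (p + α), Real.cos_neg, Real.sin_neg]
  ring

theorem branch₄_eq (α p q : ℝ) : branch₄ α p q =
    (Real.cos p - Real.sin p) * (Real.cos (-q - α) - Real.sin (-q - α)) /
      (2 * Real.sin α) := by
  rw [branch₄, show q + p + α = p - (-q - α) by ring, show q - p + α = -(p + (-q - α)) by ring,
    Real.sin_neg, Real.cos_sub p, Real.sin_add p]
  ring

section Branches

variable {α p q : ℝ}

theorem sin_pos_of_mem (hα : α ∈ Ioc 0 (Real.pi / 4)) : 0 < Real.sin α :=
  Real.sin_pos_of_pos_of_lt_pi hα.1 (by linarith [hα.2, Real.pi_pos])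

/-- The order relations of each branch put both angles in [-π/4, π/4]; the inequations exclude π/4
for the factors that could reach it. Here p - α ≤ 0, so only the second could. -/
theorem branch₁_pos (hα : α ∈ Ioc 0 (Real.pi / 4)) (h1 : -p ≤ q) (h2 : q ≤ p) (h3 : p ≤ α)
    (h4 : q ≠ -(Real.pi / 4)) : 0 < branch₁ α p q := by
  obtain ⟨hα1, hα2⟩ := id hα
  have hs := sin_pos_of_mem hα
  rw [branch₁_eq]
  exact div_pos (mul_pos (cos_sub_sin_pos (by linarith) (by linarith) (by linarith))
    (cos_sub_sin_pos (by linarith) (by linarith) fun h => h4 (by linarith))) (by linarith)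

theorem branch₂_pos (hα : α ∈ Ioc 0 (Real.pi / 4)) (h1 : -q ≤ p) (h2 : p ≤ q) (h3 : q ≤ α)
    (h4 : p ≠ Real.pi / 4) (h5 : α - q ≠ Real.pi / 4) : 0 < branch₂ α p q := by
  obtain ⟨hα1, hα2⟩ := id hα
  have hs := sin_pos_of_mem hα
  rw [branch₂_eq]
  exact div_pos (mul_pos (cos_sub_sin_pos (by linarith) (by linarith) h4)
    (cos_sub_sin_pos (by linarith) (by linarith) h5)) (by linarith)

theorem branch₃_pos (hα : α ∈ Ioc 0 (Real.pi / 4)) (h1 : p ≤ q) (h2 : q ≤ -p) (h3 : -α ≤ p)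
    (h4 : p + α ≠ Real.pi / 4) (h5 : q ≠ -(Real.pi / 4)) : 0 < branch₃ α p q := by
  obtain ⟨hα1, hα2⟩ := id hα
  have hs := sin_pos_of_mem hα
  rw [branch₃_eq]
  exact div_pos (mul_pos (cos_sub_sin_pos (by linarith) (by linarith) h4)
    (cos_sub_sin_pos (by linarith) (by linarith) fun h => h5 (by linarith))) (by linarith)

theorem branch₄_pos (hα : α ∈ Ioc 0 (Real.pi / 4)) (h1 : q ≤ p) (h2 : p ≤ -q) (h3 : -α ≤ q)
    (h4 : p ≠ Real.pi / 4) : 0 < branch₄ α p q := by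
  obtain ⟨hα1, hα2⟩ := id hα
  have hs := sin_pos_of_mem hα
  rw [branch₄_eq]
  exact div_pos (mul_pos (cos_sub_sin_pos (by linarith) (by linarith) h4)
    (cos_sub_sin_pos (by linarith) (by linarith) (by linarith))) (by linarith)

end Branches

variable {a : ℝ → ℝ} {T : ℝ}

/-- The order relations between `A(t)`, `A(s)` and `A(T)` for a nondecreasing `A`. -/
theorem primitive_order (hT : 0 ≤ T) (ha : IntegrableOn a (Icc (-T) T))
    (heven : ∀ᵐ t ∂(volume.restrict (Icc (-T) T)), a (-t) = a t)
    (hpos : ∀ᵐ t ∂(volume.restrict (Icc (-T) T)), 0 ≤ a t) {t s : ℝ}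
    (ht : t ∈ Icc (-T) T) (hs : s ∈ Icc (-T) T) :
    primitive a t ≤ primitive a T ∧ -primitive a T ≤ primitive a t ∧
    primitive a s ≤ primitive a T ∧ -primitive a T ≤ primitive a s ∧
    (t ≤ s → primitive a t ≤ primitive a s) ∧ (s ≤ t → primitive a s ≤ primitive a t) ∧
    (0 ≤ t + s → -primitive a s ≤ primitive a t) ∧
    (t + s ≤ 0 → primitive a t ≤ -primitive a s) := by
  have hm := monotoneOn_primitive hT ha hpos
  have h1 : T ∈ Icc (-T) T := ⟨by linarith, le_rfl⟩
  have h2 : -T ∈ Icc (-T) T := ⟨le_rfl, by linarith⟩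
  have h3 : -s ∈ Icc (-T) T := ⟨by linarith [hs.2], by linarith [hs.1]⟩
  rw [← primitive_neg heven hs, ← primitive_neg heven h1]
  exact ⟨hm ht h1 ht.2, hm h2 ht ht.1, hm hs h1 hs.2, hm h2 hs hs.1, fun h => hm ht hs h,
    fun h => hm hs ht h, fun h => hm h3 ht (by linarith), fun h => hm ht h3 (by linarith)⟩

theorem green_pos_of_lt (hT : 0 ≤ T) (ha : IntegrableOn a (Icc (-T) T))
    (heven : ∀ᵐ t ∂(volume.restrict (Icc (-T) T)), a (-t) = a t)
    (hpos : ∀ᵐ t ∂(volume.restrict (Icc (-T) T)), 0 ≤ a t)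
    (hα : primitive a T ∈ Ioo 0 (Real.pi / 4)) {t s : ℝ}
    (ht : t ∈ Icc (-T) T) (hs : s ∈ Icc (-T) T) :
    0 < greenRight a T t s ∧ 0 < greenLeft a T t s := by
  obtain ⟨h1, h2, h3, h4, h5, h6, h7, h8⟩ := primitive_order hT ha heven hpos ht hs
  have hα' := Ioo_subset_Ioc_self hα
  obtain ⟨hα1, hα2⟩ := hα
  have B1 (h : s ≤ t) (h' : 0 ≤ t + s) :
      0 < branch₁ (primitive a T) (primitive a t) (primitive a s) :=
    branch₁_pos hα' (by linarith [h7 h']) (h6 h) h1 (by linarith)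
  have B2 (h : t ≤ s) (h' : 0 ≤ t + s) :
      0 < branch₂ (primitive a T) (primitive a t) (primitive a s) :=
    branch₂_pos hα' (h7 h') (h5 h) h3 (by linarith) (by linarith [h5 h, h7 h'])
  have B3 (h : t ≤ s) (h' : t + s ≤ 0) :
      0 < branch₃ (primitive a T) (primitive a t) (primitive a s) :=
    branch₃_pos hα' (h5 h) (by linarith [h8 h']) h2 (by linarith [h5 h, h8 h']) (by linarith)
  have B4 (h : s ≤ t) (h' : t + s ≤ 0) :
      0 < branch₄ (primitive a T) (primitive a t) (primitive a s) :=
    branch₄_pos hα' (h6 h) (h8 h') h4 (by linarith)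
  rw [greenRight, greenLeft]
  constructor <;> split_ifs with h h' h' <;> first
    | exact B1 (by linarith) (by linarith)
    | exact B2 (by linarith) (by linarith)
    | exact B3 (by linarith) (by linarith)
    | exact B4 (by linarith) (by linarith)

/-- A vanishing factor fixes one of A(t), A(s), and the order relations squeeze the other to a
single value, giving exactly the pairs in `zerosRight`. -/
theorem greenRight_pos_of_notMem (hT : 0 ≤ T) (ha : IntegrableOn a (Icc (-T) T))
    (heven : ∀ᵐ t ∂(volume.restrict (Icc (-T) T)), a (-t) = a t)
    (hpos : ∀ᵐ t ∂(volume.restrict (Icc (-T) T)), 0 ≤ a t)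
    (hα : primitive a T = Real.pi / 4) {t s : ℝ}
    (ht : t ∈ Icc (-T) T) (hs : s ∈ Icc (-T) T) (hz : (t, s) ∉ zerosRight a T) :
    0 < greenRight a T t s := by
  obtain ⟨h1, h2, h3, h4, h5, h6, h7, h8⟩ := primitive_order hT ha heven hpos ht hs
  have hpi := Real.pi_pos
  have hα' : primitive a T ∈ Ioc 0 (Real.pi / 4) := ⟨by linarith, hα.le⟩
  simp only [zerosRight, square, mem_ofPred_eq, mem_prod, ht, hs, true_and, Prod.mk.injEq,
    mem_insert_iff, mem_singleton_iff, not_or, not_and, and_true] at hz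
  obtain ⟨z1, z2⟩ := hz
  rw [greenRight]
  split_ifs with h h' h'
  · have g6 := h6 h.le
    have g7 := h7 h'
    exact branch₁_pos hα' (by linarith) g6 h1 fun hq => z1 (by linarith) (by linarith)
  · have g6 := h6 h.le
    have g8 := h8 (by linarith)
    exact branch₄_pos hα' g6 g8 h4 fun hp => z1 (by linarith) (by linarith)
  · have g5 := h5 (by linarith)
    have g7 := h7 h'
    obtain ⟨y1, y2, y3⟩ := z2 (by linarith)
    exact branch₂_pos hα' g7 g5 h3 (fun hp => y3 (by linarith) (by linarith))
      fun hq => y2 (by linarith) (by linarith)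
  · have g5 := h5 (by linarith)
    have g8 := h8 (by linarith)
    obtain ⟨y1, y2, y3⟩ := z2 (by linarith)
    exact branch₃_pos hα' g5 (by linarith) h2 (fun hp => y2 (by linarith) (by linarith))
      fun hq => y1 (by linarith) (by linarith)

theorem greenRight_eq_zero (hT : 0 ≤ T) (ha : IntegrableOn a (Icc (-T) T))
    (heven : ∀ᵐ t ∂(volume.restrict (Icc (-T) T)), a (-t) = a t)
    (hpos : ∀ᵐ t ∂(volume.restrict (Icc (-T) T)), 0 ≤ a t)
    (hα : primitive a T = Real.pi / 4) {t s : ℝ} (hz : (t, s) ∈ zerosRight a T) :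
    greenRight a T t s = 0 := by
  have hpi := Real.pi_pos
  simp only [zerosRight, square, mem_ofPred_eq, mem_prod, Prod.mk.injEq,
    mem_insert_iff, mem_singleton_iff, hα] at hz
  obtain ⟨⟨ht, hs⟩, hz⟩ := hz
  obtain ⟨h1, h2, h3, h4, h5, h6, h7, h8⟩ := primitive_order hT ha heven hpos ht hs
  rw [greenRight, branch₁_eq, branch₂_eq, branch₃_eq, branch₄_eq, hα]
  rcases hz with ⟨hp, hq⟩ | ⟨hle, ⟨hp, hq⟩ | ⟨hp, hq⟩ | ⟨hp, hq⟩⟩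
  -- Monotonicity recovers the order of t and s from the values of A. The sign of t + s is not
  -- determined, but branches 1 and 4 both vanish at (α, -α).
  · have hst : s < t := by
      by_contra h
      linarith [h5 (not_lt.1 h)]
    simp [hp, hq, hst]
  · have hts : t + s < 0 := by
      by_contra h
      linarith [h7 (not_lt.1 h)]
    simp [hp, hq, hle.not_gt, hts.not_ge]
  -- Branches 2 and 3 both vanish at (0, 0), whatever the sign of t + s.
  · simp [hp, hq, hle.not_gt]
  · have hts : 0 ≤ t + s := by
      by_contra h
      linarith [h8 (not_le.1 h).le]
    simp [hp, hq, hle.not_gt, hts]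

theorem corners_subset_zerosRight (hT : 0 ≤ T)
    (heven : ∀ᵐ t ∂(volume.restrict (Icc (-T) T)), a (-t) = a t) :
    ({(-T, -T), (0, 0), (T, T), (T, -T)} : Set (ℝ × ℝ)) ⊆ zerosRight a T := by
  have hn := primitive_neg heven (t := T) ⟨by linarith, le_rfl⟩
  have h0 := primitive_zero a
  have hT' : -T ≤ T := by linarith
  rintro z (rfl | rfl | rfl | rfl) <;> simp [zerosRight, square, hn, h0, hT, hT']

theorem zerosRight_eq_of_injOn (hT : 0 ≤ T)
    (heven : ∀ᵐ t ∂(volume.restrict (Icc (-T) T)), a (-t) = a t)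
    (hinj : InjOn (primitive a) (Icc (-T) T)) :
    zerosRight a T = {(-T, -T), (0, 0), (T, T), (T, -T)} := by
  refine Subset.antisymm ?_ (corners_subset_zerosRight hT heven)
  rintro ⟨t, s⟩ ⟨⟨ht, hs⟩, hz⟩
  have i1 : T ∈ Icc (-T) T := ⟨by linarith, le_rfl⟩
  have i2 : -T ∈ Icc (-T) T := ⟨le_rfl, by linarith⟩
  have i3 : (0 : ℝ) ∈ Icc (-T) T := ⟨by linarith, hT⟩
  have e2 : ∀ r ∈ Icc (-T) T, primitive a r = -primitive a T → r = -T := fun r hr h =>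
    hinj hr i2 (by rw [h, primitive_neg heven i1])
  have e3 : ∀ r ∈ Icc (-T) T, primitive a r = 0 → r = 0 := fun r hr h =>
    hinj hr i3 (by rw [h, primitive_zero])
  have e1 : ∀ r ∈ Icc (-T) T, primitive a r = primitive a T → r = T := fun r hr h =>
    hinj hr i1 h
  simp only [Prod.mk.injEq, mem_insert_iff, mem_singleton_iff] at hz ⊢
  rcases hz with ⟨hp, hq⟩ | ⟨-, ⟨hp, hq⟩ | ⟨hp, hq⟩ | ⟨hp, hq⟩⟩
  · exact .inr (.inr (.inr ⟨e1 t ht hp, e2 s hs hq⟩))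
  · exact .inl ⟨e2 t ht hp, e2 s hs hq⟩
  · exact .inr (.inl ⟨e3 t ht hp, e3 s hs hq⟩)
  · exact .inr (.inr (.inl ⟨e1 t ht hp, e1 s hs hq⟩))

theorem branch_neg (α p q : ℝ) :
    branch₁ (-α) (-p) (-q) = -branch₂ α q p ∧ branch₂ (-α) (-p) (-q) = -branch₁ α q p ∧
    branch₃ (-α) (-p) (-q) = -branch₄ α q p ∧ branch₄ (-α) (-p) (-q) = -branch₃ α q p := by
  rw [branch₁_eq, branch₂_eq, branch₃_eq, branch₄_eq, branch₁_eq, branch₂_eq, branch₃_eq,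
    branch₄_eq, Real.sin_neg α, mul_neg, div_neg, div_neg]
  refine ⟨?_, ?_, ?_, ?_⟩ <;> ring_nf

/-- Transposition exchanges the two sides of the diagonal, hence also the two one-sided versions of
the kernel. -/
theorem greenLeft_fun_neg (a : ℝ → ℝ) (T t s : ℝ) :
    greenLeft (fun r => -a r) T t s = -greenRight a T s t := by
  obtain ⟨h1, h2, h3, h4⟩ := branch_neg (primitive a T) (primitive a t) (primitive a s)
  simp only [greenLeft, greenRight, primitive_fun_neg, h1, h2, h3, h4, add_comm s t]
  split_ifs <;> first | rfl | (exfalso; linarith)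

theorem greenRight_fun_neg (a : ℝ → ℝ) (T t s : ℝ) :
    greenRight (fun r => -a r) T t s = -greenLeft a T s t := by
  have h := greenLeft_fun_neg (fun r => -a r) T s t
  simp only [neg_neg] at h
  rw [h, neg_neg]

theorem mem_zerosLeft_iff {z : ℝ × ℝ} :
    z ∈ zerosLeft a T ↔ z.swap ∈ zerosRight (fun r => -a r) T := by
  simp only [zerosLeft, zerosRight, square, mem_ofPred_eq, mem_prod, Prod.fst_swap,
    Prod.snd_swap, primitive_fun_neg, Prod.mk.injEq, mem_insert_iff, mem_singleton_iff, neg_neg,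
    neg_eq_iff_eq_neg, neg_zero]
  tauto

theorem swap_mem_corners_iff {t s : ℝ} :
    (s, t) ∈ ({(-T, -T), (0, 0), (T, T), (T, -T)} : Set (ℝ × ℝ)) ↔
      (t, s) ∈ ({(-T, -T), (0, 0), (T, T), (-T, T)} : Set (ℝ × ℝ)) := by
  simp only [mem_insert_iff, mem_singleton_iff, Prod.mk.injEq]
  tauto

/-- The kernel on the side `t = T` of the square. -/
theorem green_right_side {s : ℝ} (hs : s ∈ Ico (-T) T) :
    greenRight a T T s = (Real.cos (primitive a s) + Real.sin (primitive a s)) /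
      (2 * Real.sin (primitive a T)) ∧
    greenLeft a T T s = (Real.cos (primitive a s) + Real.sin (primitive a s)) /
      (2 * Real.sin (primitive a T)) := by
  have h : 0 ≤ T + s := by linarith [hs.1]
  simp [greenRight, greenLeft, hs.2, hs.2.le, h, branch₁_eq]

/-- On the side t = T the numerator is cos A(s) + sin A(s), equal to 1 at s = 0 and negative at some
other s; the sign of sin α only decides which point gives which sign. -/
theorem exists_green_signs (hT : 0 < T) (ha : IntegrableOn a (Icc (-T) T))
    (heven : ∀ᵐ t ∂(volume.restrict (Icc (-T) T)), a (-t) = a t)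
    (hsin : Real.sin (primitive a T) ≠ 0)
    (hα : primitive a T ∉ Icc (-(Real.pi / 4)) (Real.pi / 4)) :
    (∃ z ∈ square T, z.1 ≠ z.2 ∧ 0 < greenRight a T z.1 z.2 ∧ 0 < greenLeft a T z.1 z.2) ∧
    (∃ z ∈ square T, z.1 ≠ z.2 ∧ greenRight a T z.1 z.2 < 0 ∧ greenLeft a T z.1 z.2 < 0) := by
  have h1 : T ∈ Icc (-T) T := ⟨by linarith, le_rfl⟩
  rw [mem_Icc, ← abs_le, not_le] at hα
  obtain ⟨q, hq, hq'⟩ := exists_cos_add_sin_neg hα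
  obtain ⟨s, hs, rfl⟩ := exists_primitive_eq hT.le ha heven hq.le
  -- The strict bound |q| < |α| keeps the point off the diagonal.
  have hsT : s ∈ Ico (-T) T := ⟨hs.1, lt_of_le_of_ne hs.2 fun h => by simp [h] at hq⟩
  have h0T : (0 : ℝ) ∈ Ico (-T) T := ⟨by linarith, hT⟩
  have hz : (T, s) ∈ square T := ⟨h1, hs⟩
  have hz0 : (T, (0 : ℝ)) ∈ square T := ⟨h1, Ico_subset_Icc_self h0T⟩
  obtain ⟨e1, e2⟩ := green_right_side (a := a) hsT
  obtain ⟨e3, e4⟩ := green_right_side (a := a) h0T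
  rw [primitive_zero, Real.cos_zero, Real.sin_zero, add_zero] at e3 e4
  rcases lt_or_gt_of_ne hsin with h | h
  · have p1 := div_pos_of_neg_of_neg hq' (by linarith : 2 * Real.sin (primitive a T) < 0)
    have p2 := div_neg_of_pos_of_neg one_pos (by linarith : 2 * Real.sin (primitive a T) < 0)
    exact ⟨⟨_, hz, hsT.2.ne', by rwa [e1], by rwa [e2]⟩,
      ⟨_, hz0, hT.ne', by rwa [e3], by rwa [e4]⟩⟩
  · have p1 := div_neg_of_neg_of_pos hq' (by linarith : 0 < 2 * Real.sin (primitive a T))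
    have p2 := div_pos one_pos (by linarith : 0 < 2 * Real.sin (primitive a T))
    exact ⟨⟨_, hz0, hT.ne', by rwa [e3], by rwa [e4]⟩,
      ⟨_, hz, hsT.2.ne', by rwa [e1], by rwa [e2]⟩⟩

end Kernel

/-! ### Characterization of the maximum principles -/

section MaximumPrinciples

variable {a : ℝ → ℝ} {T : ℝ}

theorem stronglyInversePositive_aePos_iff (hT : 0 < T) (ha : IntegrableOn a (Icc (-T) T))
    (heven : ∀ᵐ t ∂(volume.restrict (Icc (-T) T)), a (-t) = a t)
    (hsign : (∀ᵐ t ∂(volume.restrict (Icc (-T) T)), 0 ≤ a t) ∨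
      (∀ᵐ t ∂(volume.restrict (Icc (-T) T)), a t ≤ 0))
    (hsin : Real.sin (primitive a T) ≠ 0) (lam : ℝ) :
    StronglyInversePositive AEPos a T lam ↔
      primitive a T ∈ Ioc 0 (Real.pi / 4) ∧ 0 ≤ lam :=
  ⟨fun H => H.necessary hT ha heven hsin, fun h => stronglyInversePositive_aePos hT ha heven
    (nonneg_of_primitive_pos hT.le hsign h.1.1) h.1 h.2⟩

theorem stronglyInversePositive_aenonnegNonzero_iff (hT : 0 < T)
    (ha : IntegrableOn a (Icc (-T) T))
    (heven : ∀ᵐ t ∂(volume.restrict (Icc (-T) T)), a (-t) = a t)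
    (hsign : (∀ᵐ t ∂(volume.restrict (Icc (-T) T)), 0 ≤ a t) ∨
      (∀ᵐ t ∂(volume.restrict (Icc (-T) T)), a t ≤ 0))
    (hsin : Real.sin (primitive a T) ≠ 0)
    (hstrict : InjOn (primitive a) (Icc (-T) T) ∨ |primitive a T| ≠ Real.pi / 4) (lam : ℝ) :
    StronglyInversePositive AENonnegNonzero a T lam ↔
      primitive a T ∈ Ioc 0 (Real.pi / 4) ∧ 0 ≤ lam :=
  -- Data positive almost everywhere are also nonnegative and nontrivial, so the earlier necessary
  -- conditions apply.
  ⟨fun H => (H.mono fun _ h => h.aenonnegNonzero hT).necessary hT ha heven hsin,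
    fun h => stronglyInversePositive_aenonnegNonzero hT ha heven
      (nonneg_of_primitive_pos hT.le hsign h.1.1) h.1 hstrict h.2⟩

theorem neg_mem_Ioc_iff {α β : ℝ} : -α ∈ Ioc 0 β ↔ α ∈ Ico (-β) 0 := by
  simp only [mem_Ioc, mem_Ico]
  constructor <;> rintro ⟨h1, h2⟩ <;> constructor <;> linarith

theorem stronglyInverseNegative_aePos_iff (hT : 0 < T)
    (ha : IntegrableOn a (Icc (-T) T))
    (heven : ∀ᵐ t ∂(volume.restrict (Icc (-T) T)), a (-t) = a t)
    (hsign : (∀ᵐ t ∂(volume.restrict (Icc (-T) T)), 0 ≤ a t) ∨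
      (∀ᵐ t ∂(volume.restrict (Icc (-T) T)), a t ≤ 0))
    (hsin : Real.sin (primitive a T) ≠ 0) (lam : ℝ) :
    StronglyInverseNegative AEPos a T lam ↔
      primitive a T ∈ Ico (-(Real.pi / 4)) 0 ∧ 0 ≤ lam := by
  have ha' : IntegrableOn (fun t => -a t) (Icc (-T) T) := ha.neg
  have heven' : ∀ᵐ t ∂(volume.restrict (Icc (-T) T)), -a (-t) = -a t :=
    heven.mono fun t ht => by rw [ht]
  have hsign' : (∀ᵐ t ∂(volume.restrict (Icc (-T) T)), 0 ≤ -a t) ∨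
      (∀ᵐ t ∂(volume.restrict (Icc (-T) T)), -a t ≤ 0) :=
    hsign.symm.imp (fun h => h.mono fun t ht => by linarith)
      (fun h => h.mono fun t ht => by linarith)
  have hsin' : Real.sin (primitive (fun t => -a t) T) ≠ 0 := by
    rw [primitive_fun_neg, Real.sin_neg]
    exact neg_ne_zero.2 hsin
  have h := stronglyInversePositive_aePos_iff hT ha' heven' hsign' hsin' lam
  rw [primitive_fun_neg, neg_mem_Ioc_iff] at h
  exact (stronglyInverseNegative_iff (P := AEPos) (fun h k hk H => AEPos.comp_neg hk H)
    heven lam).trans h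

theorem injOn_primitive_fun_neg (h : InjOn (primitive a) (Icc (-T) T)) :
    InjOn (primitive fun t => -a t) (Icc (-T) T) := fun t ht s hs hts =>
  h ht hs (by simpa [primitive_fun_neg] using hts)

theorem stronglyInverseNegative_aenonnegNonzero_iff (hT : 0 < T)
    (ha : IntegrableOn a (Icc (-T) T))
    (heven : ∀ᵐ t ∂(volume.restrict (Icc (-T) T)), a (-t) = a t)
    (hsign : (∀ᵐ t ∂(volume.restrict (Icc (-T) T)), 0 ≤ a t) ∨
      (∀ᵐ t ∂(volume.restrict (Icc (-T) T)), a t ≤ 0))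
    (hsin : Real.sin (primitive a T) ≠ 0)
    (hstrict : InjOn (primitive a) (Icc (-T) T) ∨ |primitive a T| ≠ Real.pi / 4) (lam : ℝ) :
    StronglyInverseNegative AENonnegNonzero a T lam ↔
      primitive a T ∈ Ico (-(Real.pi / 4)) 0 ∧ 0 ≤ lam := by
  have ha' : IntegrableOn (fun t => -a t) (Icc (-T) T) := ha.neg
  have heven' : ∀ᵐ t ∂(volume.restrict (Icc (-T) T)), -a (-t) = -a t :=
    heven.mono fun t ht => by rw [ht]
  have hsign' : (∀ᵐ t ∂(volume.restrict (Icc (-T) T)), 0 ≤ -a t) ∨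
      (∀ᵐ t ∂(volume.restrict (Icc (-T) T)), -a t ≤ 0) :=
    hsign.symm.imp (fun h => h.mono fun t ht => by linarith)
      (fun h => h.mono fun t ht => by linarith)
  have hsin' : Real.sin (primitive (fun t => -a t) T) ≠ 0 := by
    rw [primitive_fun_neg, Real.sin_neg]
    exact neg_ne_zero.2 hsin
  have h := stronglyInversePositive_aenonnegNonzero_iff hT ha' heven' hsign' hsin'
    (hstrict.imp injOn_primitive_fun_neg fun h => by rwa [primitive_fun_neg, abs_neg]) lam
  rw [primitive_fun_neg, neg_mem_Ioc_iff] at h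
  exact (stronglyInverseNegative_iff (P := AENonnegNonzero)
    (fun h k hk H => AENonnegNonzero.comp_neg hk H) heven lam).trans h

end MaximumPrinciples

end ReflectionGreen

end

theorem mainTheorem3 (T : ℝ) (hT : 0 < T) (a : ℝ → ℝ)
    (ha : IntegrableOn a (Icc (-T) T))
    (heven : ∀ᵐ t ∂(volume.restrict (Icc (-T) T)), a (-t) = a t)
    (hsign : (∀ᵐ t ∂(volume.restrict (Icc (-T) T)), 0 ≤ a t) ∨
      (∀ᵐ t ∂(volume.restrict (Icc (-T) T)), a t ≤ 0))
    (hsin : ∀ n : ℕ, (ReflectionGreen.primitive a T) ^ 2 ≠ ((n : ℝ) * Real.pi) ^ 2)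
    (hcos : Real.cos (ReflectionGreen.primitive a T) ≠ 0) :
    -- signs of the kernel
    (ReflectionGreen.primitive a T ∈ Ioo 0 (Real.pi / 4) →
      ∀ z ∈ ReflectionGreen.square T,
        0 < ReflectionGreen.greenRight a T z.1 z.2 ∧
        0 < ReflectionGreen.greenLeft a T z.1 z.2) ∧
    (ReflectionGreen.primitive a T ∈ Ioo (-(Real.pi / 4)) 0 →
      ∀ z ∈ ReflectionGreen.square T,
        ReflectionGreen.greenRight a T z.1 z.2 < 0 ∧
        ReflectionGreen.greenLeft a T z.1 z.2 < 0) ∧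
    (ReflectionGreen.primitive a T = Real.pi / 4 →
      (∀ z ∈ ReflectionGreen.zerosRight a T, ReflectionGreen.greenRight a T z.1 z.2 = 0) ∧
      (∀ z ∈ ReflectionGreen.square T \ ReflectionGreen.zerosRight a T,
        0 < ReflectionGreen.greenRight a T z.1 z.2) ∧
      (({(-T, -T), (0, 0), (T, T), (T, -T)} : Set (ℝ × ℝ)) ⊆
        ReflectionGreen.zerosRight a T) ∧
      (InjOn (ReflectionGreen.primitive a) (Icc (-T) T) →
        ReflectionGreen.zerosRight a T = {(-T, -T), (0, 0), (T, T), (T, -T)})) ∧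
    (ReflectionGreen.primitive a T = -(Real.pi / 4) →
      (∀ z ∈ ReflectionGreen.zerosLeft a T, ReflectionGreen.greenLeft a T z.1 z.2 = 0) ∧
      (∀ z ∈ ReflectionGreen.square T \ ReflectionGreen.zerosLeft a T,
        ReflectionGreen.greenLeft a T z.1 z.2 < 0) ∧
      (({(-T, -T), (0, 0), (T, T), (-T, T)} : Set (ℝ × ℝ)) ⊆
        ReflectionGreen.zerosLeft a T) ∧
      (InjOn (ReflectionGreen.primitive a) (Icc (-T) T) →
        ReflectionGreen.zerosLeft a T = {(-T, -T), (0, 0), (T, T), (-T, T)})) ∧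
    (ReflectionGreen.primitive a T ∉ Icc (-(Real.pi / 4)) (Real.pi / 4) →
      (∃ z ∈ ReflectionGreen.square T, z.1 ≠ z.2 ∧
        0 < ReflectionGreen.greenRight a T z.1 z.2 ∧
        0 < ReflectionGreen.greenLeft a T z.1 z.2) ∧
      (∃ z ∈ ReflectionGreen.square T, z.1 ≠ z.2 ∧
        ReflectionGreen.greenRight a T z.1 z.2 < 0 ∧
        ReflectionGreen.greenLeft a T z.1 z.2 < 0)) ∧
    -- maximum and anti-maximum principles, data positive almost everywhere
    (∀ lam : ℝ,
      (ReflectionGreen.StronglyInversePositive ReflectionGreen.AEPos a T lam ↔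
        ReflectionGreen.primitive a T ∈ Ioc 0 (Real.pi / 4) ∧ 0 ≤ lam) ∧
      (ReflectionGreen.StronglyInverseNegative ReflectionGreen.AEPos a T lam ↔
        ReflectionGreen.primitive a T ∈ Ico (-(Real.pi / 4)) 0 ∧ 0 ≤ lam)) ∧
    -- the same for nonnegative nontrivial data
    (InjOn (ReflectionGreen.primitive a) (Icc (-T) T) ∨
        |ReflectionGreen.primitive a T| ≠ Real.pi / 4 → ∀ lam : ℝ,
      (ReflectionGreen.StronglyInversePositive ReflectionGreen.AENonnegNonzero a T lam ↔
        ReflectionGreen.primitive a T ∈ Ioc 0 (Real.pi / 4) ∧ 0 ≤ lam) ∧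
      (ReflectionGreen.StronglyInverseNegative ReflectionGreen.AENonnegNonzero a T lam ↔
        ReflectionGreen.primitive a T ∈ Ico (-(Real.pi / 4)) 0 ∧ 0 ≤ lam)) := by
  have hs : Real.sin (ReflectionGreen.primitive a T) ≠ 0 := by
    intro h
    obtain ⟨n, hn⟩ := Real.sin_eq_zero_iff.1 h
    -- The hypothesis ranges over natural numbers, and squaring absorbs the sign of the integer.
    refine hsin n.natAbs ?_
    rw [← hn, mul_pow, mul_pow, Nat.cast_natAbs, Int.cast_abs, sq_abs]
  have ha' : IntegrableOn (fun t => -a t) (Icc (-T) T) := ha.neg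
  have heven' : ∀ᵐ t ∂(volume.restrict (Icc (-T) T)), -a (-t) = -a t :=
    heven.mono fun t ht => by rw [ht]
  have hsign' : (∀ᵐ t ∂(volume.restrict (Icc (-T) T)), 0 ≤ -a t) ∨
      (∀ᵐ t ∂(volume.restrict (Icc (-T) T)), -a t ≤ 0) :=
    hsign.symm.imp (fun h => h.mono fun t ht => by linarith)
      (fun h => h.mono fun t ht => by linarith)
  have hprim : ReflectionGreen.primitive (fun t => -a t) = fun t => -ReflectionGreen.primitive a t :=
    funext (ReflectionGreen.primitive_fun_neg a)
  have hpi := Real.pi_pos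
  have hpos := ReflectionGreen.nonneg_of_primitive_pos hT.le hsign
  have hpos' := ReflectionGreen.nonneg_of_primitive_pos hT.le hsign'
  have hright : ∀ t s, ReflectionGreen.greenRight a T t s =
      -ReflectionGreen.greenLeft (fun r => -a r) T s t := fun t s => by
    rw [ReflectionGreen.greenLeft_fun_neg, neg_neg]
  have hleft : ∀ t s, ReflectionGreen.greenLeft a T t s =
      -ReflectionGreen.greenRight (fun r => -a r) T s t := fun t s => by
    rw [ReflectionGreen.greenRight_fun_neg, neg_neg]
  refine ⟨fun hα z hz => ?_, fun hα z hz => ?_, fun hα => ⟨fun z hz => ?_, fun z hz => ?_, ?_, ?_⟩,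
    fun hα => ⟨fun z hz => ?_, fun z hz => ?_, ?_, ?_⟩, fun hα => ?_, fun lam => ⟨?_, ?_⟩,
    fun hstrict lam => ⟨?_, ?_⟩⟩
  · exact ReflectionGreen.green_pos_of_lt hT.le ha heven (hpos hα.1) hα hz.1 hz.2
  · have hα' : ReflectionGreen.primitive (fun t => -a t) T ∈ Ioo 0 (Real.pi / 4) := by
      rw [hprim]
      exact ⟨by linarith [hα.2], by linarith [hα.1]⟩
    obtain ⟨h1, h2⟩ := ReflectionGreen.green_pos_of_lt hT.le ha' heven' (hpos' hα'.1) hα' hz.2 hz.1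
    rw [hright, hleft]
    exact ⟨by linarith, by linarith⟩
  · exact ReflectionGreen.greenRight_eq_zero hT.le ha heven (hpos (by linarith)) hα hz
  · exact ReflectionGreen.greenRight_pos_of_notMem hT.le ha heven (hpos (by linarith)) hα
      hz.1.1 hz.1.2 hz.2
  · exact ReflectionGreen.corners_subset_zerosRight hT.le heven
  · exact ReflectionGreen.zerosRight_eq_of_injOn hT.le heven
  · have hα' : ReflectionGreen.primitive (fun t => -a t) T = Real.pi / 4 := by
      rw [hprim]
      linarith
    rw [hleft, ReflectionGreen.greenRight_eq_zero hT.le ha' heven' (hpos' (by linarith)) hα'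
      (ReflectionGreen.mem_zerosLeft_iff.1 hz), neg_zero]
  · have hα' : ReflectionGreen.primitive (fun t => -a t) T = Real.pi / 4 := by
      rw [hprim]
      linarith
    have h := ReflectionGreen.greenRight_pos_of_notMem hT.le ha' heven' (hpos' (by linarith)) hα'
      hz.1.2 hz.1.1 fun h => hz.2 (ReflectionGreen.mem_zerosLeft_iff.2 h)
    rw [hleft]
    linarith
  · intro z hz
    refine ReflectionGreen.mem_zerosLeft_iff.2
      (ReflectionGreen.corners_subset_zerosRight hT.le heven' ?_)
    rcases hz with rfl | rfl | rfl | rfl <;> simp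
  · intro hinj
    ext ⟨t, s⟩
    rw [ReflectionGreen.mem_zerosLeft_iff,
      ReflectionGreen.zerosRight_eq_of_injOn hT.le heven'
        (ReflectionGreen.injOn_primitive_fun_neg hinj)]
    exact ReflectionGreen.swap_mem_corners_iff
  · exact ReflectionGreen.exists_green_signs hT ha heven hs hα
  · exact ReflectionGreen.stronglyInversePositive_aePos_iff hT ha heven hsign hs lam
  · exact ReflectionGreen.stronglyInverseNegative_aePos_iff hT ha heven hsign hs lam
  · exact ReflectionGreen.stronglyInversePositive_aenonnegNonzero_iff hT ha heven hsign hs hstrict lam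
  · exact ReflectionGreen.stronglyInverseNegative_aenonnegNonzero_iff hT ha heven hsign hs hstrict lam
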